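/- \textbf{Setting.} Let $q\in\mathbb C^*$ with $|q|<1$, and let $$\vartheta(x)=\big(x^{1/2}-x^{-1/2}\big)\varphi(qx)\varphi(q/x),\qquad \varphi(x)=\prod_{s=0}^{\infty}(1-q^sx)$$ be the skew Jacobi theta function. Let $n$ be a non-negative integer, let $z=(z_1,\dots,z_n)$, $\mu=(\mu_1,\dots,\mu_n)$ and $\hbar$ be non-zero complex parameters, and fix a square root of each of them; for a Laurent monomial $x$ in the parameters, $x^{1/2}$ always means the same Laurent monomial in the chosen square roots. For a permutation $I=(I_1,\dots,I_n)\in\mathfrak S_n$ and $0\le k\le n$ let $i^{(k)}_1<\dots<i^{(k)}_k$ be the elements of $\{I_1,\dots,I_k\}$ in increasing order. For variables $t=(t^{(k)}_a)_{1\le a\le k\le n-1}$, and with $t^{(n)}_i=z_i$, put $$U_I(t,z,\hbar,\mu)=\prod_{k=1}^{n-1}\frac{\prod_{a=1}^{k}\prod_{c=1}^{k+1}\psi_{I,k,a,c}\big(t^{(k+1)}_c/t^{(k)}_a\big)}{\prod_{1\le a<b\le k}\vartheta\big(t^{(k)}_a\hbar/t^{(k)}_b\big)\,\vartheta\big(t^{(k)}_b/t^{(k)}_a\big)},$$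 $$\psi_{I,k,a,c}(x)=\begin{cases}\vartheta(\hbar x),& i^{(k+1)}_c<i^{(k)}_a,\\ \vartheta\big(x\,\hbar^{1-p}\,\mu_{k+1}/\mu_{j}\big),& i^{(k+1)}_c=i^{(k)}_a,\\ \vartheta(x),& i^{(k+1)}_c>i^{(k)}_a,\end{cases}$$ where $j$ is defined by $I_j=i^{(k)}_a$, and $p=1$ if $I_{k+1}<i^{(k)}_a$, $p=0$ if $I_{k+1}\ge i^{(k)}_a$. The elliptic weight function $W_I(t,z,\hbar,\mu)$ is the symmetrization of $U_I$ (the sum over all permutations) in each of the groups of variables $t^{(k)}=(t^{(k)}_1,\dots,t^{(k)}_k)$, $1\le k\le n-1$. For $J\in\mathfrak S_n$ let $z_J$ denote the substitution $t^{(k)}_a=z_{j^{(k)}_a}$, where $j^{(k)}_1<\dots<j^{(k)}_k$ are the elements of $\{J_1,\dots,J_k\}$. The restriction matrix is $$A_{I,J}(z,\mu)=W_I(z_J,z,\hbar,\mu),\qquad I,J\in\mathfrak S_n .$$ \textbf{Theorem.} Let $\sigma_0=(n,n-1,\dots,1)$ be the longest permutation in $\mathfrak S_n$, and write $\sigma\cdot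 I$ for the permutation $m\mapsto I_{\sigma(m)}$. Then for all $I,J\in\mathfrak S_n$ $$A_{I,J}(z,\mu)=(-1)^{n(n-1)/2}\,A_{J^{-1}\cdot\sigma_0,\;I^{-1}\cdot\sigma_0}\big(\mu_{\sigma_0(1)},\dots,\mu_{\sigma_0(n)},\,z_1^{-1},\dots,z_n^{-1}\big)$$ as an identity of meromorphic functions of $z,\mu,\hbar$ (with the same $\hbar$ on both sides); that is, it holds whenever none of the denominators in the two symmetrized sums vanishes. Here the chosen square root of $z_i^{-1}$ is the inverse of the chosen square root of $z_i$. -/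

import Mathlib

noncomputable section

namespace FlagMirror

open Finset

/-- The infinite product `φ(x) = ∏_{s ≥ 0} (1 - q^s x)`. -/
def phi (q x : ℂ) : ℂ := ∏' s : ℕ, (1 - q ^ s * x)

/-- The skew Jacobi theta function `θ(x) = (x^{1/2} - x^{-1/2}) φ(q x) φ(q / x)`.
It is double-valued in `x`, so it is written as a function of the chosen square root
`r = x^{1/2}`, that is, `x = r ^ 2`. All the parameters below (`z`, `μ`, `ħ` and the Chern roots
`t`) are likewise given by chosen square roots; products and quotients of parameters then
correspond to products and quotients of these square roots. -/
def theta (q r : ℂ) : ℂ := (r - r⁻¹) * phi q (q * r ^ 2) * phi q (q / r ^ 2)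

variable {n : ℕ}

/-- The set `{I_1, …, I_k}`, for `0 ≤ k ≤ n`. Permutations are written with indices starting
from `0`, so that `I_{m+1}` is `I m` for `m : Fin n`. -/
def initialSet (I : Equiv.Perm (Fin n)) (k : Fin (n + 1)) : Finset (Fin n) :=
  (univ.filter fun m : Fin n => (m : ℕ) < k).map I.toEmbedding

theorem card_initialSet (I : Equiv.Perm (Fin n)) (k : Fin (n + 1)) :
    (initialSet I k).card = (k : ℕ) := by
  rw [initialSet, card_map, Fin.card_filter_val_lt]
  exact min_eq_right (Nat.lt_succ_iff.mp k.isLt)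

/-- The ordered indices `i^{(k)}_1 < ⋯ < i^{(k)}_k`, the increasing enumeration of
`{I_1, …, I_k}`. -/
def sortedIndex (I : Equiv.Perm (Fin n)) (k : Fin (n + 1)) : Fin k ↪o Fin n :=
  (initialSet I k).orderEmbOfFin (card_initialSet I k)

/-- `p_{I,j}(m) = 1` if `I_j < m` and `0` if `I_j ≥ m`. -/
def pFun (I : Equiv.Perm (Fin n)) (j m : Fin n) : ℤ := if I j < m then 1 else 0

/-- The function `ψ_{I,k,a,c}`, for `0 ≤ k ≤ n - 1`, `1 ≤ a ≤ k`, `1 ≤ c ≤ k + 1`, as a function of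
the square root `x` of its argument; `h` and `μ` are square roots of `ħ` and of the dynamical
parameters. The parameter `μ_{k+1}` is `μ k`, the number `I_{k+1}` is `I k`, and the index `j` with
`I_j = i^{(k)}_a` is `I.symm (i^{(k)}_a)`. -/
def psi (q h : ℂ) (μ : Fin n → ℂ) (I : Equiv.Perm (Fin n)) (k : Fin n)
    (a : Fin k.castSucc) (c : Fin k.succ) (x : ℂ) : ℂ :=
  if sortedIndex I k.succ c < sortedIndex I k.castSucc a then
    theta q (h * x)
  else if sortedIndex I k.succ c = sortedIndex I k.castSucc a then
    theta q (x * h ^ (1 - pFun I k (sortedIndex I k.castSucc a)) * μ k /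
      μ (I.symm (sortedIndex I k.castSucc a)))
  else
    theta q x

/-- The Chern roots `t^{(k)}_a`, `1 ≤ a ≤ k ≤ n - 1` (there are none for `k = 0`). -/
abbrev ChernRoots (n : ℕ) : Type := (k : Fin n) → Fin k → ℂ

/-- The Chern roots extended to the level `n` by the convention `t^{(n)}_i = z_i`. -/
def extendRoots (t : ChernRoots n) (z : Fin n → ℂ) : (k : Fin (n + 1)) → Fin k → ℂ :=
  Fin.snoc (α := fun k : Fin (n + 1) => Fin k → ℂ) t z

/-- The function `U_I(t, z, ħ, μ)`. The factor with `k = 0` is an empty product. -/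
def preWeight (q h : ℂ) (I : Equiv.Perm (Fin n)) (t : ChernRoots n) (z μ : Fin n → ℂ) : ℂ :=
  ∏ k : Fin n,
    (∏ a : Fin k.castSucc, ∏ c : Fin k.succ,
        psi q h μ I k a c (extendRoots t z k.succ c / extendRoots t z k.castSucc a)) /
      (∏ a : Fin k, ∏ b ∈ Ioi a, theta q (t k a * h / t k b) * theta q (t k b / t k a))

/-- The elliptic weight function `W_I(t, z, ħ, μ)`: the symmetrization (sum over all permutations)
of `U_I` in each of the groups of variables `t^{(1)}, …, t^{(n-1)}`. -/
def weight (q h : ℂ) (I : Equiv.Perm (Fin n)) (t : ChernRoots n) (z μ : Fin n → ℂ) : ℂ :=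
  ∑ τ : (k : Fin n) → Equiv.Perm (Fin k), preWeight q h I (fun k a => t k (τ k a)) z μ

/-- The restriction `z_J` of the Chern roots to the fixed point `J`: `t^{(k)}_a = z_{j^{(k)}_a}`,
where `j^{(k)}_1 < ⋯ < j^{(k)}_k` is the increasing enumeration of `{J_1, …, J_k}`. -/
def fixedPointRoots (z : Fin n → ℂ) (J : Equiv.Perm (Fin n)) : ChernRoots n :=
  fun k a => z (sortedIndex J k.castSucc a)

/-- The restriction matrix `A_{I,J}(z, μ) = W_I(z_J, z, ħ, μ)`. -/
def restrictionMatrix (q h : ℂ) (I J : Equiv.Perm (Fin n)) (z μ : Fin n → ℂ) : ℂ :=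
  weight q h I (fixedPointRoots z J) z μ

/-- None of the denominators of the symmetrized sum `W_I(t, z, ħ, μ)` vanishes at `t`
(they do not depend on `I`, `z`, `μ`). -/
def DenominatorsNonzero (q h : ℂ) (t : ChernRoots n) : Prop :=
  ∀ (k : Fin n) (a b : Fin k), a ≠ b →
    theta q (t k a * h / t k b) ≠ 0 ∧ theta q (t k b / t k a) ≠ 0

end FlagMirror

end

/-! For generic parameters the matrix `A` is determined by its row `I = 1` together with a recursion
in `I`, and the mirror matrix satisfies the same recursion with the same initial row up to sign.

The recursion is the R-matrix relation `fixedWeight_exchange`: for an adjacent transposition `s`,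
the entry at `(s I, J)` with parameters `z` is a combination of the entries at `(I, J)` with `z` and
at `(I, s J)` with `z ∘ s`. It is proved level by level. When the values `I r₁` and `I r₂` are
consecutive, no other value lies between them, so the level-`k` factor depends essentially on these
labels only through a small minor of theta factors. The relation thus reduces to theta identities
(`base_relation`, `step_relation`), consequences of the three-term relation. The latter holds
because theta functions of degree two form a space of dimension at most two.

On the mirror side `I` and `J` are inverted and interchanged, so left multiplication by `s` becomes
right multiplication and a dual recursion is needed: `fixedWeight_exchange_right`, which moves the
dynamical parameters. Left and right multiplication commute, so the dual recursion propagates along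
the R-matrix relation and needs checking only for `I = 1`.

Initial rows come from triangularity. A kernel contains a vanishing `θ(1)` unless the fixed point is
compatible with `I`; hence `A` vanishes off the diagonal when `I = 1` or `J` is the longest
permutation, and its diagonal entries are explicit products. Comparing them uses `θ(1/x) = -θ(x)`
once for each pair, which is the sign `(-1)^(n(n-1)/2)`.

Generic parameters accumulate at any given ones along a one-parameter deformation, and both sides
are continuous where the denominators do not vanish; this removes the genericity assumption. -/

noncomputable section

namespace FlagMirror

open Finset

/-! ### Laurent expansions and the three-term theta relation. -/

section Theta

/-- `g` is represented on `ℂ ∖ {0}` by a convergent Laurent series with coefficients `a`. -/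
def HasLaurent (g : ℂ → ℂ) (a : ℤ → ℂ) : Prop :=
  ∀ X : ℂ, X ≠ 0 → HasSum (fun m : ℤ => a m * X ^ m) (g X)

/-- Terms with equal exponent are grouped along the fibres of `e`. This turns Taylor series and
Cauchy products into Laurent series. -/
theorem exists_hasLaurent {ι : Type*} (e : ι → ℤ) (c : ι → ℂ) {g : ℂ → ℂ}
    (hg : ∀ X : ℂ, X ≠ 0 → HasSum (fun i => c i * X ^ e i) (g X)) :
    ∃ a, HasLaurent g a := by
  refine ⟨fun m => ∑' i : {i // e i = m}, c i, fun X hX => ?_⟩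
  have h1 := (Equiv.sigmaFiberEquiv e).hasSum_iff.mpr (hg X hX)
  have h2 := h1.sigma fun m => (h1.summable.sigma_factor m).hasSum
  convert! h2 using 2 with m
  rw [← tsum_mul_right]
  refine tsum_congr fun i => ?_
  simp [i.2]

theorem HasLaurent.exists_mul {f g : ℂ → ℂ} {a b : ℤ → ℂ} (hf : HasLaurent f a)
    (hg : HasLaurent g b) : ∃ c, HasLaurent (fun X => f X * g X) c := by
  have key : ∀ X : ℂ, X ≠ 0 →
      HasSum (fun p : ℤ × ℤ => (a p.1 * b p.2) * X ^ (p.1 + p.2)) (f X * g X) := by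
    intro X hX
    have h1 : Summable fun p : ℤ × ℤ => (a p.1 * X ^ p.1) * (b p.2 * X ^ p.2) :=
      summable_mul_of_summable_norm (f := fun m : ℤ => a m * X ^ m)
        (g := fun m : ℤ => b m * X ^ m) (hf X hX).summable.norm (hg X hX).summable.norm
    have h : HasSum (fun p : ℤ × ℤ => (a p.1 * X ^ p.1) * (b p.2 * X ^ p.2)) (f X * g X) := by
      rw [← (hf X hX).tsum_eq, ← (hg X hX).tsum_eq,
        (hf X hX).summable.tsum_mul_tsum (hg X hX).summable h1]
      exact h1.hasSum
    refine h.congr_fun fun p => ?_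
    rw [zpow_add₀ hX]
    ring
  exact exists_hasLaurent (fun p : ℤ × ℤ => p.1 + p.2) (fun p => a p.1 * b p.2) key

theorem HasLaurent.comp_const_mul {f : ℂ → ℂ} {a : ℤ → ℂ} (hf : HasLaurent f a) {y : ℂ}
    (hy : y ≠ 0) : HasLaurent (fun X => f (X * y)) (fun m => a m * y ^ m) := by
  intro X hX
  have h := hf (X * y) (mul_ne_zero hX hy)
  convert! h using 2 with m
  rw [mul_zpow]
  ring

/-- Uniqueness of Laurent coefficients by Fourier analysis: on the unit circle the series converges
absolutely in the uniform norm, so it may be paired termwise in `L²` with the `k`-th character,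
which extracts `a k`. -/
theorem HasLaurent.eq_zero {a : ℤ → ℂ} (h : HasLaurent (fun _ => 0) a) : a = 0 := by
  funext k
  have hs : Summable fun m => ‖a m‖ := by
    simpa using (h 1 one_ne_zero).summable.norm
  have hT : Fact (0 < 2 * Real.pi) := ⟨Real.two_pi_pos⟩
  let F : ℤ → C(AddCircle (2 * Real.pi), ℂ) := fun m => a m • fourier m
  have hF : Summable F := by
    refine Summable.of_norm ?_
    simpa [F, norm_smul, fourier_norm] using hs
  have h0 : HasSum F 0 := by
    have : ∑' m, F m = 0 := by
      ext x
      rw [← ContinuousMap.tsum_apply hF]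
      have h1 := (h (fourier 1 x) (by
        simp)).tsum_eq
      refine Eq.trans (tsum_congr fun m => ?_) h1
      simp [F, fourier_apply, AddCircle.toCircle_zsmul]
    exact this ▸ hF.hasSum
  have h1 := (ContinuousMap.toLp (E := ℂ) 2 AddCircle.haarAddCircle ℂ).hasSum h0
  have h2 := (innerSL ℂ (fourierLp (T := 2 * Real.pi) 2 k)).hasSum h1
  have h3 : HasSum (fun m => if m = k then a k else 0) (0 : ℂ) := by
    convert! h2 using 2 with m
    · have ho := (orthonormal_iff_ite.mp (orthonormal_fourier (T := 2 * Real.pi))) k m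
      simp only [F, map_smul, innerSL_apply_apply, smul_eq_mul]
      change _ = a m * inner ℂ (fourierLp 2 k) (fourierLp 2 m)
      rw [ho]
      by_cases hm : m = k
      · simp [hm]
      · simp [hm, Ne.symm hm]
    · simp
  exact (hasSum_ite_eq k (a k)).unique h3

variable {q : ℂ}

theorem multipliable_phi (hq : ‖q‖ < 1) (x : ℂ) :
    Multipliable fun s : ℕ => 1 - q ^ s * x := by
  simp_rw [sub_eq_add_neg]
  refine multipliable_one_add_of_summable ?_
  simpa using (summable_geometric_of_lt_one (norm_nonneg _) hq).mul_right ‖x‖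

theorem phi_eq (hq : ‖q‖ < 1) (x : ℂ) : phi q x = (1 - x) * phi q (q * x) := by
  have h : (fun s : ℕ => 1 - q ^ (s + 1) * x) = fun s : ℕ => 1 - q ^ s * (q * x) := by
    funext s
    ring
  rw [phi, tprod_eq_zero_mul' (by rw [h]; exact multipliable_phi hq _), h, phi]
  simp

theorem differentiable_phi (hq : ‖q‖ < 1) : Differentiable ℂ (phi q) := by
  intro x
  have h : HasProdLocallyUniformlyOn (fun (s : ℕ) (x : ℂ) => 1 + -(q ^ s * x))
      (fun x => ∏' s : ℕ, (1 + -(q ^ s * x))) (Metric.ball 0 (‖x‖ + 1)) := by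
    refine Summable.hasProdLocallyUniformlyOn_nat_one_add Metric.isOpen_ball
      ((summable_geometric_of_lt_one (norm_nonneg _) hq).mul_right (‖x‖ + 1))
      (.of_forall fun s y hy => ?_) fun s => by fun_prop
    rw [norm_neg, norm_mul, norm_pow]
    gcongr
    simpa using (Metric.mem_ball.mp hy).le
  have hd := h.differentiableOn (.of_forall fun _ => by
    simpa [Finset.prod_fn] using DifferentiableOn.finsetProd (fun _ _ => by fun_prop))
      Metric.isOpen_ball
  have := (hd x (by simp)).differentiableAt (Metric.isOpen_ball.mem_nhds (by simp))
  refine this.congr_of_eventuallyEq (.of_forall fun y => ?_)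
  simp [phi, sub_eq_add_neg]

theorem phi_ne_zero (hq : ‖q‖ < 1) {x : ℂ} (hx : ∀ s : ℕ, q ^ s * x ≠ 1) : phi q x ≠ 0 := by
  have h := tprod_one_add_ne_zero_of_summable (f := fun s : ℕ => -(q ^ s * x))
    (fun s => by
      rw [← sub_eq_add_neg, sub_ne_zero]
      exact (hx s).symm)
    (by simpa using (summable_geometric_of_lt_one (norm_nonneg _) hq).mul_right ‖x‖)
  simpa [phi, sub_eq_add_neg] using h

theorem theta_inv (r : ℂ) : theta q r⁻¹ = -theta q r := by
  simp only [theta, inv_inv, inv_pow, div_inv_eq_mul, ← div_eq_mul_inv]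
  ring

theorem theta_one : theta q 1 = 0 := by simp [theta]

theorem continuousAt_theta (hq : ‖q‖ < 1) {r : ℂ} (hr : r ≠ 0) :
    ContinuousAt (theta q) r := by
  have hc := (differentiable_phi hq).continuous
  have h1 : ContinuousAt (fun r : ℂ => phi q (q / r ^ 2)) r :=
    hc.continuousAt.comp (continuousAt_const.div (by fun_prop) (pow_ne_zero 2 hr))
  have h2 : ContinuousAt (fun r : ℂ => phi q (q * r ^ 2)) r :=
    (hc.comp (by fun_prop)).continuousAt
  exact ((continuousAt_id.sub (continuousAt_id.inv₀ hr)).mul h2).mul h1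

/-- The zeros of theta lie over the discrete set `q ^ ℤ`; this is what makes non-generic parameters
exceptional. -/
theorem theta_ne_zero (hq : ‖q‖ < 1) {r : ℂ} (hr : r ≠ 0)
    (h : ∀ k : ℤ, r ^ 2 ≠ q ^ k) : theta q r ≠ 0 := by
  refine mul_ne_zero (mul_ne_zero ?_ (phi_ne_zero hq fun s hs => ?_))
    (phi_ne_zero hq fun s hs => ?_)
  · intro h0
    apply h 0
    field_simp at h0
    simpa [sub_eq_zero] using h0
  · apply h (-(s + 1 : ℕ))
    rw [zpow_neg, zpow_natCast]
    refine eq_inv_of_mul_eq_one_right ?_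
    rw [← hs]
    ring
  · apply h (s + 1 : ℕ)
    rw [zpow_natCast]
    field_simp at hs
    rw [← hs]
    ring

/-- The theta function without its half-integral power prefactor, `φ(X) φ(q / X)`. -/
def phiPair (q X : ℂ) : ℂ := phi q X * phi q (q / X)

theorem theta_eq (hq : ‖q‖ < 1) {r : ℂ} (hr : r ≠ 0) :
    theta q r = -r⁻¹ * phiPair q (r ^ 2) := by
  rw [theta, phiPair, phi_eq hq (r ^ 2)]
  field_simp
  ring

theorem mul_phiPair (hq0 : q ≠ 0) (hq : ‖q‖ < 1) {X : ℂ} (hX : X ≠ 0) :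
    X * phiPair q (q * X) = -phiPair q X := by
  rw [phiPair, phiPair, phi_eq hq X, phi_eq hq (q / (q * X))]
  have h : q * (q / (q * X)) = q / X := by field_simp
  rw [h]
  field_simp
  ring

theorem exists_hasLaurent_phiPair (hq : ‖q‖ < 1) : ∃ a, HasLaurent (phiPair q) a := by
  have ht (X : ℂ) := Complex.hasSum_taylorSeries_of_entire (differentiable_phi hq) 0 X
  obtain ⟨a, ha⟩ : ∃ a, HasLaurent (phi q) a := by
    refine exists_hasLaurent (fun k : ℕ => (k : ℤ))
      (fun k => (k.factorial : ℂ)⁻¹ * iteratedDeriv k (phi q) 0) fun X _ => ?_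
    convert! ht X using 2 with k
    simp only [zpow_natCast, sub_zero, smul_eq_mul]
    ring
  obtain ⟨b, hb⟩ : ∃ b, HasLaurent (fun X => phi q (q / X)) b := by
    refine exists_hasLaurent (fun k : ℕ => -(k : ℤ))
      (fun k => (k.factorial : ℂ)⁻¹ * iteratedDeriv k (phi q) 0 * q ^ k) fun X _ => ?_
    convert! ht (q / X) using 2 with k
    simp only [zpow_neg, zpow_natCast, sub_zero, smul_eq_mul, div_eq_mul_inv, mul_pow, inv_pow]
    ring
  exact ha.exists_mul hb

/-- The space of degree two theta functions, as Laurent series satisfying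
`X ^ 2 g(q X) = g(X)`. -/
def IsDegreeTwo (q : ℂ) (g : ℂ → ℂ) : Prop :=
  (∃ a, HasLaurent g a) ∧ ∀ X, X ≠ 0 → X ^ 2 * g (q * X) = g X

/-- Comparing coefficients in the functional equation gives a two-step recursion, so `a 0` and `a 1`
determine the whole series. -/
theorem HasLaurent.coeff_add_two {g : ℂ → ℂ} {a : ℤ → ℂ} (hq0 : q ≠ 0) (ha : HasLaurent g a)
    (hg : ∀ X, X ≠ 0 → X ^ 2 * g (q * X) = g X) (m : ℤ) : a (m + 2) = q ^ m * a m := by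
  have h : HasLaurent (fun _ => 0) fun m => a m - q ^ (m - 2) * a (m - 2) := by
    intro X hX
    have h1 := ((ha (q * X) (mul_ne_zero hq0 hX)).mul_left (X ^ 2))
    rw [hg X hX, ← (Equiv.subRight (2 : ℤ)).hasSum_iff] at h1
    have h2 := (ha X hX).sub h1
    rw [sub_self] at h2
    convert! h2 using 2 with m
    simp only [Function.comp, Equiv.subRight_apply, mul_zpow]
    rw [show X ^ m = X ^ 2 * X ^ (m - 2) by rw [← zpow_natCast, ← zpow_add₀ hX]; congr 1; simp]
    ring
  have := congrFun h.eq_zero (m + 2)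
  simpa [sub_eq_zero] using this

theorem HasLaurent.eq_zero_of_coeff {g : ℂ → ℂ} {a : ℤ → ℂ} (hq0 : q ≠ 0)
    (ha : HasLaurent g a) (hg : ∀ X, X ≠ 0 → X ^ 2 * g (q * X) = g X) (h0 : a 0 = 0)
    (h1 : a 1 = 0) : ∀ X, X ≠ 0 → g X = 0 := by
  have hr := ha.coeff_add_two hq0 hg
  have h : ∀ m : ℤ, a m = 0 ∧ a (m + 1) = 0 := by
    intro m
    induction m using Int.induction_on with
    | zero => exact ⟨h0, h1⟩
    | succ k ih => exact ⟨ih.2, by rw [add_assoc]; norm_num [hr, ih.1]⟩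
    | pred k ih =>
      have := hr (-(k : ℤ) - 1)
      rw [show -(k : ℤ) - 1 + 2 = -k + 1 by ring, ih.2] at this
      exact ⟨by simpa [zpow_ne_zero _ hq0] using this.symm, by simpa using ih.1⟩
  intro X hX
  have := ha X hX
  simp only [(h _).1, zero_mul] at this
  exact this.unique hasSum_zero

/-- Three degree two theta functions are linearly dependent. -/
theorem exists_linear_relation (hq0 : q ≠ 0) {f g k : ℂ → ℂ} (hf : IsDegreeTwo q f)
    (hg : IsDegreeTwo q g) (hk : IsDegreeTwo q k) :
    ∃ α β γ : ℂ, (α ≠ 0 ∨ β ≠ 0 ∨ γ ≠ 0) ∧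
      ∀ X, X ≠ 0 → α * f X + β * g X + γ * k X = 0 := by
  obtain ⟨⟨a, ha⟩, hf⟩ := hf
  obtain ⟨⟨b, hb⟩, hg⟩ := hg
  obtain ⟨⟨c, hc⟩, hk⟩ := hk
  -- Two coefficients of three functions form a `2 × 3` matrix, which has a nonzero kernel vector.
  obtain ⟨v, hv, hv0⟩ : ∃ v : Fin 3 → ℂ,
      (Matrix.of ![![a 0, b 0, c 0], ![a 1, b 1, c 1]]).mulVec v = 0 ∧ v ≠ 0 := by
    by_contra! hcon
    have hinj : Function.Injective
        (Matrix.toLin' (Matrix.of ![![a 0, b 0, c 0], ![a 1, b 1, c 1]])) := by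
      rw [← LinearMap.ker_eq_bot, LinearMap.ker_eq_bot']
      exact fun v hv => hcon v (by simpa using hv)
    have := LinearMap.finrank_le_finrank_of_injective hinj
    simp at this
  have e0 := congrFun hv 0
  have e1 := congrFun hv 1
  simp [Matrix.mulVec, dotProduct, Fin.sum_univ_three] at e0 e1
  refine ⟨v 0, v 1, v 2, ?_, ?_⟩
  · by_contra! h
    apply hv0
    funext i
    fin_cases i
    exacts [h.1, h.2.1, h.2.2]
  · have hs : HasLaurent (fun X => v 0 * f X + v 1 * g X + v 2 * k X)
        fun m => v 0 * a m + v 1 * b m + v 2 * c m := by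
      intro X hX
      have h := (((ha X hX).mul_left (v 0)).add ((hb X hX).mul_left (v 1))).add
        ((hc X hX).mul_left (v 2))
      convert! h using 2 with m
      ring
    refine hs.eq_zero_of_coeff hq0 (fun X hX => ?_) ?_ ?_
    · rw [← hf X hX, ← hg X hX, ← hk X hX]
      ring
    · linear_combination e0
    · linear_combination e1

/-- The product `θ(x y) θ(x / y)`. -/
def thetaPair (q x y : ℂ) : ℂ := theta q (x * y) * theta q (x / y)

theorem thetaPair_swap (x y : ℂ) : thetaPair q y x = -thetaPair q x y := by
  rw [thetaPair, thetaPair, ← inv_div x y, theta_inv, mul_comm y x]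
  ring

theorem thetaPair_self {x : ℂ} (hx : x ≠ 0) : thetaPair q x x = 0 := by
  rw [thetaPair, div_self hx, theta_one, mul_zero]

/-- The factor `x ^ 2` cancels the prefactors `(x y)⁻¹` and `(x / y)⁻¹` of the two thetas, leaving a
function of `X = x ^ 2`. The two quasi-periodicity multipliers combine to `X⁻²`, independently of
`y`. -/
theorem exists_isDegreeTwo (hq0 : q ≠ 0) (hq : ‖q‖ < 1) {y : ℂ} (hy : y ≠ 0) :
    ∃ g, IsDegreeTwo q g ∧ ∀ x, x ≠ 0 → x ^ 2 * thetaPair q x y = g (x ^ 2) := by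
  obtain ⟨a, ha⟩ := exists_hasLaurent_phiPair hq
  have hy2 := pow_ne_zero 2 hy
  refine ⟨fun X => phiPair q (X * y ^ 2) * phiPair q (X * (y ^ 2)⁻¹),
    ⟨(ha.comp_const_mul hy2).exists_mul (ha.comp_const_mul (inv_ne_zero hy2)), ?_⟩, ?_⟩
  · intro X hX
    have h1 := mul_phiPair hq0 hq (mul_ne_zero hX hy2)
    have h2 := mul_phiPair hq0 hq (mul_ne_zero hX (inv_ne_zero hy2))
    simp only [mul_assoc q X]
    have h3 : X ^ 2 = (X * y ^ 2) * (X * (y ^ 2)⁻¹) := by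
      field_simp
    rw [h3]
    linear_combination (X * (y ^ 2)⁻¹ * phiPair q (q * (X * (y ^ 2)⁻¹))) * h1 -
      phiPair q (X * y ^ 2) * h2
  · intro x hx
    rw [thetaPair, theta_eq hq (mul_ne_zero hx hy), theta_eq hq (div_ne_zero hx hy), mul_pow,
      div_pow, div_eq_mul_inv (x ^ 2)]
    field_simp

/-- As functions of `x`, the pairs with second argument `y`, `u`, `v` are linearly dependent.
Evaluating the dependence at `x = u` and `x = v`, where one pair vanishes, determines the
coefficients up to scale; `huv` ensures that the coefficient of the `y` term is nonzero. -/
theorem thetaPair_relation_aux (hq0 : q ≠ 0) (hq : ‖q‖ < 1) {x y u v : ℂ} (hx : x ≠ 0)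
    (hy : y ≠ 0) (hu : u ≠ 0) (hv : v ≠ 0) (huv : thetaPair q u v ≠ 0) :
    thetaPair q x y * thetaPair q u v - thetaPair q x u * thetaPair q y v +
      thetaPair q x v * thetaPair q y u = 0 := by
  obtain ⟨f, hf, hf'⟩ := exists_isDegreeTwo hq0 hq hy
  obtain ⟨g, hg, hg'⟩ := exists_isDegreeTwo hq0 hq hu
  obtain ⟨k, hk, hk'⟩ := exists_isDegreeTwo hq0 hq hv
  obtain ⟨α, β, γ, hne, h⟩ := exists_linear_relation hq0 hf hg hk
  have h' : ∀ x, x ≠ 0 →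
      α * thetaPair q x y + β * thetaPair q x u + γ * thetaPair q x v = 0 := by
    intro x hx
    have := h (x ^ 2) (pow_ne_zero 2 hx)
    rw [← hf' x hx, ← hg' x hx, ← hk' x hx] at this
    refine mul_left_cancel₀ (pow_ne_zero 2 hx) ?_
    linear_combination this
  have hu' := h' u hu
  have hv' := h' v hv
  have hx' := h' x hx
  rw [thetaPair_self hu, thetaPair_swap y u] at hu'
  rw [thetaPair_self hv, thetaPair_swap u v, thetaPair_swap y v] at hv'
  have hα : α ≠ 0 := by
    rintro rfl
    have hγ : γ = 0 := by simpa [huv] using hu'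
    have hβ : β = 0 := by simpa [huv, hγ] using hv'
    simp [hβ, hγ] at hne
  refine mul_left_cancel₀ hα ?_
  linear_combination thetaPair q u v * hx' - thetaPair q x u * (-hv') - hu' * thetaPair q x v

/-- The three-term relation for theta functions. -/
theorem thetaPair_relation (hq0 : q ≠ 0) (hq : ‖q‖ < 1) {x y u v : ℂ} (hx : x ≠ 0)
    (hy : y ≠ 0) (hu : u ≠ 0) (hv : v ≠ 0) :
    thetaPair q x y * thetaPair q u v - thetaPair q x u * thetaPair q y v +
      thetaPair q x v * thetaPair q y u = 0 := by
  -- Up to signs the relation is symmetric in `y`, `u`, `v`, so one nonvanishing pair among them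
  -- suffices; if all three vanish, every term is zero.
  by_cases huv : thetaPair q u v = 0
  · by_cases hyv : thetaPair q y v = 0
    · by_cases hyu : thetaPair q y u = 0
      · simp [huv, hyv, hyu]
      · have h := thetaPair_relation_aux hq0 hq hx hv hy hu hyu
        rw [thetaPair_swap u v, thetaPair_swap y v] at h
        linear_combination h
    · have h := thetaPair_relation_aux hq0 hq hx hu hy hv hyv
      rw [thetaPair_swap y u] at h
      linear_combination -h
  · exact thetaPair_relation_aux hq0 hq hx hy hu hv huv

/-- The three-term relation for theta functions, without square roots of the parameters. -/
theorem theta_three_term (hq0 : q ≠ 0) (hq : ‖q‖ < 1) {s a b c : ℂ} (hs : s ≠ 0) (ha : a ≠ 0)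
    (hb : b ≠ 0) (hc : c ≠ 0) :
    theta q s * theta q a * (theta q (s / (a * b ^ 2 * c)) * theta q c) -
      theta q (s / b) * theta q (a * b) * (theta q (s / (a * b * c)) * theta q (b * c)) +
      theta q (s / (b * c)) * theta q (a * b * c) * (theta q (s / (a * b)) * theta q b) = 0 := by
  -- The substitution is `x² = s a`, `y = x / a`, `u = x / (a b)`, `v = x / (a b c)`; then all sums
  -- and differences of arguments are free of the auxiliary root.
  obtain ⟨x, hx⟩ := IsAlgClosed.exists_eq_mul_self (s * a)
  have hx0 : x ≠ 0 := by
    rintro rfl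
    simp [hs, ha] at hx
  have hs' : s = x * x / a := by
    rw [← hx]
    field_simp
  have h := thetaPair_relation hq0 hq hx0 (div_ne_zero hx0 ha)
    (div_ne_zero hx0 (mul_ne_zero ha hb))
    (div_ne_zero hx0 (mul_ne_zero (mul_ne_zero ha hb) hc))
  simp only [thetaPair] at h
  have e1 : x * (x / a) = s := by rw [hs']; ring
  have e2 : x / (x / a) = a := by field_simp
  have e3 : x / (a * b) * (x / (a * b * c)) = s / (a * b ^ 2 * c) := by rw [hs']; field_simp
  have e4 : x / (a * b) / (x / (a * b * c)) = c := by field_simp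
  have e5 : x * (x / (a * b)) = s / b := by rw [hs']; field_simp
  have e6 : x / (x / (a * b)) = a * b := by field_simp
  have e7 : x / a * (x / (a * b * c)) = s / (a * b * c) := by rw [hs']; field_simp
  have e8 : x / a / (x / (a * b * c)) = b * c := by field_simp
  have e9 : x * (x / (a * b * c)) = s / (b * c) := by rw [hs']; field_simp
  have e10 : x / (x / (a * b * c)) = a * b * c := by field_simp
  have e11 : x / a * (x / (a * b)) = s / (a * b) := by rw [hs']; field_simp
  have e12 : x / a / (x / (a * b)) = b := by field_simp
  rw [e1, e2, e3, e4, e5, e6, e7, e8, e9, e10, e11, e12] at h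
  exact h

end Theta

/-! ### The kernels of one level and their exchange relations. -/

section Exchange

section Minors

variable {α β : Type*} [Fintype α] [Fintype β] [DecidableEq α] [DecidableEq β]

/-- The product of the entries of `E` outside of the `2 × 2` minor with rows `r₁, r₂` and columns
`c₁, c₂`. -/
def offMinor (E : α → β → ℂ) (r₁ r₂ : α) (c₁ c₂ : β) : ℂ :=
  (∏ a ∈ ({r₁, r₂} : Finset α)ᶜ, ∏ c, E a c) * ∏ c ∈ ({c₁, c₂} : Finset β)ᶜ, (E r₁ c * E r₂ c)

theorem prod_eq_minor_mul_offMinor (E : α → β → ℂ) {r₁ r₂ : α} {c₁ c₂ : β} (hr : r₁ ≠ r₂)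
    (hc : c₁ ≠ c₂) :
    ∏ a, ∏ c, E a c = E r₁ c₁ * E r₁ c₂ * (E r₂ c₁ * E r₂ c₂) * offMinor E r₁ r₂ c₁ c₂ := by
  rw [offMinor, ← prod_mul_prod_compl ({r₁, r₂} : Finset α), prod_pair hr, ← prod_mul_distrib,
    ← prod_mul_prod_compl ({c₁, c₂} : Finset β), prod_pair hc]
  ring

theorem offMinor_congr {E E' : α → β → ℂ} {r₁ r₂ : α} {c₁ c₂ : β}
    (h₁ : ∀ a, a ≠ r₁ → a ≠ r₂ → ∏ c, E a c = ∏ c, E' a c)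
    (h₂ : ∀ c, c ≠ c₁ → c ≠ c₂ → E r₁ c * E r₂ c = E' r₁ c * E' r₂ c) :
    offMinor E r₁ r₂ c₁ c₂ = offMinor E' r₁ r₂ c₁ c₂ := by
  unfold offMinor
  congr 1
  · refine prod_congr rfl fun a ha => ?_
    simp only [mem_compl, mem_insert, mem_singleton, not_or] at ha
    exact h₁ a ha.1 ha.2
  · refine prod_congr rfl fun c hc => ?_
    simp only [mem_compl, mem_insert, mem_singleton, not_or] at hc
    exact h₂ c hc.1 hc.2

end Minors

variable (q h : ℂ)

/-- The factor `ψ` in the labelling of the Chern roots of level `k` by the times `0, …, k - 1`: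
the root with label `m` belongs to the element `I m`. -/
def entry (I : ℕ → ℕ) (μ : ℕ → ℂ) (k a c : ℕ) (x : ℂ) : ℂ :=
  if I c < I a then theta q (h * x)
  else if c = a then theta q (x * h ^ (1 - if I k < I a then 1 else 0 : ℤ) * μ k / μ a)
  else theta q x

/-- The factor of the denominator attached to the roots with labels `a` and `b`. -/
def pairFactor (I : ℕ → ℕ) {k : ℕ} (x : Fin k → ℂ) (a b : Fin k) : ℂ :=
  if I a < I b then theta q (x a * h / x b) * theta q (x b / x a) else 1

/-- The factor of level `k` of the elliptic weight function. -/
def kern (I : ℕ → ℕ) (μ : ℕ → ℂ) (k : ℕ) (x : Fin k → ℂ) (y : Fin (k + 1) → ℂ) : ℂ :=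
  (∏ a : Fin k, ∏ c : Fin (k + 1), entry q h I μ k a c (y c / x a)) /
    ∏ a : Fin k, ∏ b : Fin k, pairFactor q h I x a b

/-- The partial elliptic weight functions restricted to a fixed point: the roots of each level `k`
are `w 0, …, w (k - 1)` in any order, and those of the last level are given by `y`. -/
def partialWeight (I : ℕ → ℕ) (μ w : ℕ → ℂ) : (k : ℕ) → (Fin k → ℂ) → ℂ
  | 0, _ => 1
  | k + 1, y => ∑ τ : Equiv.Perm (Fin k),
      partialWeight I μ w k (fun a => w (τ a)) * kern q h I μ k (fun a => w (τ a)) y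

variable {q h}

section Relations

/-- The identity needed when the larger of two consecutive values occurs at the newest time: one row
and two columns are involved. -/
theorem base_relation (hq0 : q ≠ 0) (hq : ‖q‖ < 1) {m y₁ y₂ u : ℂ} (hh : h ≠ 0) (hm : m ≠ 0)
    (hy₁ : y₁ ≠ 0) (hy₂ : y₂ ≠ 0) (hu : u ≠ 0) :
    theta q (h * m) * theta q (y₂ / y₁) * (theta q (h * (y₁ / u)) * theta q (y₂ / u * m)) =
      theta q h * theta q (y₂ / y₁ * m) * (theta q (y₁ / u * h * m) * theta q (y₂ / u)) -
        theta q (h * (y₁ / y₂)) * theta q m * (theta q (y₂ / u * h * m) * theta q (y₁ / u)) := by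
  have h0 := theta_three_term hq0 hq (s := y₂ / u * h * m) (a := m) (b := y₂ / y₁) (c := y₁ / u)
    (by simp [*]) hm (by simp [*]) (by simp [*])
  have e1 : y₂ / u * h * m / (m * (y₂ / y₁) ^ 2 * (y₁ / u)) = h * (y₁ / y₂) := by field_simp
  have e2 : y₂ / u * h * m / (y₂ / y₁) = y₁ / u * h * m := by field_simp
  have e3 : y₂ / u * h * m / (m * (y₂ / y₁) * (y₁ / u)) = h := by field_simp
  have e4 : y₂ / y₁ * (y₁ / u) = y₂ / u := by field_simp
  have e5 : y₂ / u * h * m / (y₂ / u) = h * m := by field_simp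
  have e6 : m * (y₂ / y₁) * (y₁ / u) = y₂ / u * m := by field_simp
  have e7 : y₂ / u * h * m / (m * (y₂ / y₁)) = h * (y₁ / u) := by field_simp
  rw [e1, e2, e3, e4, e5, e6, e7, mul_comm m] at h0
  linear_combination h0

/-- This and `step_relation_snd` are instances of the three-term relation whose right-hand sides
share the factor `θ(v y₁ / (u y₂))`. That factor is absent from `step_relation`, where the two
right-hand sides cancel. -/
theorem step_relation_fst (hq0 : q ≠ 0) (hq : ‖q‖ < 1) {y₁ y₂ u v : ℂ} (hh : h ≠ 0)
    (hy₁ : y₁ ≠ 0) (hy₂ : y₂ ≠ 0) (hu : u ≠ 0) (hv : v ≠ 0) :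
    theta q (y₂ / y₁) * theta q (y₂ / v) * theta q (u * h / v) * theta q (h * (y₁ / u)) -
      theta q (v / u) * theta q (y₁ / u) * theta q (h * (y₁ / y₂)) * theta q (h * (y₂ / v)) =
    -(theta q h * theta q (h * (y₁ / v)) * theta q (y₂ / u) * theta q (v * y₁ / (u * y₂))) := by
  have h0 := theta_three_term hq0 hq (s := h * (y₁ / u)) (a := y₂ / v) (b := v * y₁ / (u * y₂))
    (c := u * h / v) (by simp [*]) (by simp [*]) (by simp [*]) (by simp [*])
  have e1 : h * (y₁ / u) / (y₂ / v * (v * y₁ / (u * y₂)) ^ 2 * (u * h / v)) = y₂ / y₁ := by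
    field_simp
  have e2 : h * (y₁ / u) / (v * y₁ / (u * y₂)) = h * (y₂ / v) := by field_simp
  have e3 : y₂ / v * (v * y₁ / (u * y₂)) = y₁ / u := by field_simp
  have e4 : h * (y₁ / u) / (y₁ / u * (u * h / v)) = v / u := by field_simp
  have e5 : v * y₁ / (u * y₂) * (u * h / v) = h * (y₁ / y₂) := by field_simp
  have e6 : h * (y₁ / u) / (h * (y₁ / y₂)) = y₂ / u := by field_simp
  have e7 : y₁ / u * (u * h / v) = h * (y₁ / v) := by field_simp
  have e8 : h * (y₁ / u) / (y₁ / u) = h := by field_simp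
  rw [e1, e2, e3, e4, e5, e6, e7, e8] at h0
  linear_combination h0

theorem step_relation_snd (hq0 : q ≠ 0) (hq : ‖q‖ < 1) {y₁ y₂ u v M₁ M₂ : ℂ}
    (hy₁ : y₁ ≠ 0) (hy₂ : y₂ ≠ 0) (hu : u ≠ 0) (hv : v ≠ 0) (hM₁ : M₁ ≠ 0) (hM₂ : M₂ ≠ 0) :
    theta q (y₂ / y₁) * theta q (y₁ / u * M₂) * theta q (v / u * (M₁ / M₂)) *
        theta q (y₂ / v * M₁) -
      theta q (v / u) * theta q (y₂ / v * M₂) * theta q (y₂ / y₁ * (M₁ / M₂)) *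
        theta q (y₁ / u * M₁) =
    -(theta q (M₁ / M₂) * theta q (y₂ / u * M₁) * theta q (y₁ / v * M₂) *
        theta q (v * y₁ / (u * y₂))) := by
  have h0 := theta_three_term hq0 hq (s := y₁ / u * M₂) (a := y₂ / y₁) (b := v * y₁ / (u * y₂))
    (c := y₂ / v * M₁) (by simp [*]) (by simp [*]) (by simp [*]) (by simp [*])
  have e1 : y₁ / u * M₂ / (y₂ / y₁ * (v * y₁ / (u * y₂)) ^ 2 * (y₂ / v * M₁)) =
      (v / u * (M₁ / M₂))⁻¹ := by
    field_simp
  have e2 : y₁ / u * M₂ / (v * y₁ / (u * y₂)) = y₂ / v * M₂ := by field_simp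
  have e3 : y₂ / y₁ * (v * y₁ / (u * y₂)) = v / u := by field_simp
  have e4 : y₁ / u * M₂ / (v / u * (y₂ / v * M₁)) = (y₂ / y₁ * (M₁ / M₂))⁻¹ := by field_simp
  have e5 : v * y₁ / (u * y₂) * (y₂ / v * M₁) = y₁ / u * M₁ := by field_simp
  have e6 : y₁ / u * M₂ / (y₁ / u * M₁) = (M₁ / M₂)⁻¹ := by field_simp
  have e7 : v / u * (y₂ / v * M₁) = y₂ / u * M₁ := by field_simp
  have e8 : y₁ / u * M₂ / (v / u) = y₁ / v * M₂ := by field_simp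
  rw [e1, e2, e3, e4, e5, e6, e7, e8, theta_inv, theta_inv, theta_inv] at h0
  linear_combination -h0

/-- The exchange relation for the `2 × 2` minors of the factors of the weight function. -/
theorem step_relation (hq0 : q ≠ 0) (hq : ‖q‖ < 1) {y₁ y₂ u v M₁ M₂ : ℂ} (hh : h ≠ 0)
    (hy₁ : y₁ ≠ 0) (hy₂ : y₂ ≠ 0) (hu : u ≠ 0) (hv : v ≠ 0) (hM₁ : M₁ ≠ 0) (hM₂ : M₂ ≠ 0) :
    theta q (y₂ / y₁) *
      (theta q h * theta q (v / u * (M₁ / M₂)) *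
          (theta q (y₁ / u * M₂) * theta q (y₂ / u) *
            (theta q (h * (y₁ / v)) * theta q (y₂ / v * M₁))) -
        theta q (M₁ / M₂) * theta q (u * h / v) *
          (theta q (y₁ / v * M₂) * theta q (y₂ / v) *
            (theta q (h * (y₁ / u)) * theta q (y₂ / u * M₁)))) =
    theta q (v / u) *
      (theta q h * theta q (y₂ / y₁ * (M₁ / M₂)) *
          (theta q (y₁ / u * M₁) * theta q (y₂ / u) *
            (theta q (h * (y₁ / v)) * theta q (y₂ / v * M₂))) -
        theta q (h * (y₁ / y₂)) * theta q (M₁ / M₂) *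
          (theta q (y₂ / u * M₁) * theta q (y₁ / u) *
            (theta q (h * (y₂ / v)) * theta q (y₁ / v * M₂)))) := by
  have h1 := step_relation_fst (h := h) hq0 hq hh hy₁ hy₂ hu hv
  have h2 := step_relation_snd hq0 hq hy₁ hy₂ hu hv hM₁ hM₂
  linear_combination theta q h * theta q (y₂ / u) * theta q (h * (y₁ / v)) * h2 -
    theta q (M₁ / M₂) * theta q (y₂ / u * M₁) * theta q (y₁ / v * M₂) * h1

end Relations

theorem entry_congr {I I' : ℕ → ℕ} {μ : ℕ → ℂ} {k a c : ℕ} (x : ℂ)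
    (h₁ : I c < I a ↔ I' c < I' a) (h₂ : I k < I a ↔ I' k < I' a) :
    entry q h I μ k a c x = entry q h I' μ k a c x := by
  simp only [entry, h₁, h₂]

/-- Only the relative order of the values at times `0, …, k` enters the kernel. -/
theorem kern_congr {I I' : ℕ → ℕ} {μ : ℕ → ℂ} {k : ℕ} (x : Fin k → ℂ) (y : Fin (k + 1) → ℂ)
    (hI : ∀ a b, a ≤ k → b ≤ k → (I a < I b ↔ I' a < I' b)) :
    kern q h I μ k x y = kern q h I' μ k x y := by
  unfold kern
  congr 1
  · refine prod_congr rfl fun a _ => prod_congr rfl fun c _ => ?_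
    exact entry_congr _ (hI _ _ c.is_le a.2.le) (hI _ _ le_rfl a.2.le)
  · refine prod_congr rfl fun a _ => prod_congr rfl fun b _ => ?_
    simp only [pairFactor, hI _ _ a.2.le b.2.le]

theorem partialWeight_congr {I I' : ℕ → ℕ} {μ w : ℕ → ℂ} {k : ℕ} (y : Fin k → ℂ)
    (hI : ∀ a b, a < k → b < k → (I a < I b ↔ I' a < I' b)) :
    partialWeight q h I μ w k y = partialWeight q h I' μ w k y := by
  induction k with
  | zero => rfl
  | succ k ih =>
    unfold partialWeight
    refine sum_congr rfl fun τ _ => ?_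
    rw [ih _ fun a b ha hb => hI a b (by omega) (by omega),
      kern_congr _ _ fun a b ha hb => hI a b (by omega) (by omega)]

theorem val_swap {k : ℕ} (r₁ r₂ a : Fin k) :
    ((Equiv.swap r₁ r₂ a : Fin k) : ℕ) = Equiv.swap (r₁ : ℕ) r₂ a := by
  simp only [Equiv.swap_apply_def, Fin.ext_iff]
  split_ifs <;> rfl

/-- The comparisons with `I r₁` and with `I r₂ = I r₁ + 1` agree away from `r₁` and `r₂`. -/
theorem swap_lt_iff {I : ℕ → ℕ} (hinj : Function.Injective I) {r₁ r₂ : ℕ}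
    (hI : I r₂ = I r₁ + 1) {a b : ℕ} (hab : ¬((a = r₁ ∨ a = r₂) ∧ (b = r₁ ∨ b = r₂))) :
    (I (Equiv.swap r₁ r₂ a) < I (Equiv.swap r₁ r₂ b) ↔ I a < I b) := by
  have h0 : ∀ a, a ≠ r₁ → a ≠ r₂ → I a ≠ I r₁ ∧ I a ≠ I r₂ := fun a h1 h2 =>
    ⟨hinj.ne h1, hinj.ne h2⟩
  by_cases ha1 : a = r₁
  · subst ha1
    have hb : b ≠ a ∧ b ≠ r₂ := by tauto
    rw [Equiv.swap_apply_left, Equiv.swap_apply_of_ne_of_ne hb.1 hb.2]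
    have := h0 b hb.1 hb.2
    omega
  by_cases ha2 : a = r₂
  · subst ha2
    have hb : b ≠ r₁ ∧ b ≠ a := by tauto
    rw [Equiv.swap_apply_right, Equiv.swap_apply_of_ne_of_ne hb.1 hb.2]
    have := h0 b hb.1 hb.2
    omega
  rw [Equiv.swap_apply_of_ne_of_ne ha1 ha2]
  have := h0 a ha1 ha2
  by_cases hb1 : b = r₁
  · subst hb1
    rw [Equiv.swap_apply_left]
    omega
  by_cases hb2 : b = r₂
  · subst hb2
    rw [Equiv.swap_apply_right]
    omega
  rw [Equiv.swap_apply_of_ne_of_ne hb1 hb2]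

/-- Renaming the labels of rows and columns changes no product. An exchange of values of `I` can
therefore be traded for an exchange of dynamical parameters. -/
theorem kern_comp_swap {I : ℕ → ℕ} {μ : ℕ → ℂ} {k : ℕ} (r₁ r₂ : Fin k) (x : Fin k → ℂ)
    (y : Fin (k + 1) → ℂ) :
    kern q h (I ∘ Equiv.swap (r₁ : ℕ) r₂) μ k (x ∘ Equiv.swap r₁ r₂)
        (y ∘ Equiv.swap r₁.castSucc r₂.castSucc) =
      kern q h I (μ ∘ Equiv.swap (r₁ : ℕ) r₂) k x y := by
  have hk : Equiv.swap (r₁ : ℕ) r₂ k = k :=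
    Equiv.swap_apply_of_ne_of_ne r₁.2.ne' r₂.2.ne'
  have hs : ∀ a b, Equiv.swap (r₁ : ℕ) r₂ a = Equiv.swap (r₁ : ℕ) r₂ b ↔ a = b := fun a b =>
    (Equiv.swap (r₁ : ℕ) r₂).apply_eq_iff_eq
  unfold kern
  congr 1
  · refine Fintype.prod_equiv (Equiv.swap r₁ r₂) _ _ fun a =>
      Fintype.prod_equiv (Equiv.swap r₁.castSucc r₂.castSucc) _ _ fun c => ?_
    simp only [entry, Function.comp_apply, val_swap, Fin.val_castSucc, hk, hs,
      Equiv.swap_apply_self]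
  · refine Fintype.prod_equiv (Equiv.swap r₁ r₂) _ _ fun a =>
      Fintype.prod_equiv (Equiv.swap r₁ r₂) _ _ fun c => ?_
    simp only [pairFactor, Function.comp_apply, val_swap]

section Step

variable {I : ℕ → ℕ} {μ : ℕ → ℂ} {k : ℕ} {r₁ r₂ : Fin k}

variable (q h) in
/-- The factor of level `k` without the contribution of the labels `r₁` and `r₂`. -/
def kernRest (I : ℕ → ℕ) (μ : ℕ → ℂ) (k : ℕ) (r₁ r₂ : Fin k) (x : Fin k → ℂ)
    (y : Fin (k + 1) → ℂ) : ℂ :=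
  offMinor (fun (a : Fin k) (c : Fin (k + 1)) => entry q h I μ k a c (y c / x a)) r₁ r₂
      r₁.castSucc r₂.castSucc /
    offMinor (fun a b : Fin k => pairFactor q h I x a b) r₁ r₂ r₁ r₂

/-- Since `I k` cannot lie between two consecutive values, it compares in the same way with both,
and the same power `g` of `h` occurs in both diagonal entries of the minor. -/
theorem kern_eq (hinj : Function.Injective I) (hI : I r₂ = I r₁ + 1) (x : Fin k → ℂ)
    (y : Fin (k + 1) → ℂ) {g : ℂ} (hg : g = h ^ (1 - if I k < I r₁ then 1 else 0 : ℤ)) :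
    kern q h I μ k x y =
      theta q (y r₁.castSucc / x r₁ * (g * μ k / μ r₁)) * theta q (y r₂.castSucc / x r₁) *
        (theta q (h * (y r₁.castSucc / x r₂)) *
          theta q (y r₂.castSucc / x r₂ * (g * μ k / μ r₂))) /
        (theta q (x r₁ * h / x r₂) * theta q (x r₂ / x r₁)) * kernRest q h I μ k r₁ r₂ x y := by
  have hr : r₁ ≠ r₂ := by
    rintro rfl
    omega
  have hr' : r₁.castSucc ≠ r₂.castSucc := fun h => hr (Fin.castSucc_injective _ h)
  have hn : (r₂ : ℕ) ≠ r₁ := fun h => hr (Fin.ext h.symm)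
  have hk : I k ≠ I r₁ := hinj.ne r₁.2.ne'
  have hp : (if I k < I r₂ then 1 else 0 : ℤ) = if I k < I r₁ then 1 else 0 := by
    congr 1
    exact propext (by omega)
  have hlt : I r₁ < I r₂ := by omega
  rw [kern, prod_eq_minor_mul_offMinor _ hr hr', prod_eq_minor_mul_offMinor _ hr hr, kernRest,
    mul_div_mul_comm]
  congr 2
  · simp only [entry, Fin.val_castSucc, lt_irrefl, if_false, if_true, hlt, hlt.not_gt, hn, hp, ← hg,
      mul_assoc, mul_div_assoc]
  · simp only [pairFactor, lt_irrefl, if_false, hlt, hlt.not_gt, if_true, mul_one, one_mul]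

/-- The parameters `μ r₁` and `μ r₂` occur only in diagonal entries inside the minor. -/
theorem kernRest_comp_param (x : Fin k → ℂ) (y : Fin (k + 1) → ℂ) :
    kernRest q h I (μ ∘ Equiv.swap (r₁ : ℕ) r₂) k r₁ r₂ x y = kernRest q h I μ k r₁ r₂ x y := by
  have hk : Equiv.swap (r₁ : ℕ) r₂ k = k :=
    Equiv.swap_apply_of_ne_of_ne r₁.2.ne' r₂.2.ne'
  unfold kernRest
  congr 1
  refine offMinor_congr (fun a h₁ h₂ => prod_congr rfl fun c _ => ?_) fun c h₁ h₂ => ?_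
  · have ha : Equiv.swap (r₁ : ℕ) r₂ a = a := by rw [← val_swap, Equiv.swap_apply_of_ne_of_ne h₁ h₂]
    simp only [entry, Function.comp_apply, hk, ha]
  · have h₁' : (c : ℕ) ≠ r₁ := fun h => h₁ (Fin.ext h)
    have h₂' : (c : ℕ) ≠ r₂ := fun h => h₂ (Fin.ext h)
    simp only [entry, h₁', h₂', if_false]

theorem entry_swap_col (hinj : Function.Injective I) (hI : I r₂ = I r₁ + 1) {a : Fin k}
    (h₁ : a ≠ r₁) (h₂ : a ≠ r₂) (c : Fin (k + 1)) (x : ℂ) :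
    entry q h I μ k a (Equiv.swap r₁.castSucc r₂.castSucc c : Fin (k + 1)) x =
      entry q h I μ k a c x := by
  have h₁' : (a : ℕ) ≠ r₁ := fun h => h₁ (Fin.ext h)
  have h₂' : (a : ℕ) ≠ r₂ := fun h => h₂ (Fin.ext h)
  have ha := Equiv.swap_apply_of_ne_of_ne h₁' h₂'
  have hlt := swap_lt_iff hinj hI (a := c) (b := a) (by tauto)
  rw [ha] at hlt
  have heq : Equiv.swap (r₁ : ℕ) r₂ c = a ↔ (c : ℕ) = a := by
    rw [← Equiv.apply_eq_iff_eq (Equiv.swap (r₁ : ℕ) r₂), Equiv.swap_apply_self, ha]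
  simp only [entry, val_swap, Fin.val_castSucc, hlt, heq]

theorem entry_row_eq (hinj : Function.Injective I) (hI : I r₂ = I r₁ + 1) {c : Fin (k + 1)}
    (h₁ : c ≠ r₁.castSucc) (h₂ : c ≠ r₂.castSucc) (x : ℂ) :
    entry q h I μ k r₂ c x = entry q h I μ k r₁ c x := by
  have h₁' : (c : ℕ) ≠ r₁ := fun h => h₁ (Fin.ext h)
  have h₂' : (c : ℕ) ≠ r₂ := fun h => h₂ (Fin.ext h)
  have hlt : I c < I r₂ ↔ I c < I r₁ := by
    have := hinj.ne h₁'
    omega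
  simp only [entry, h₁', h₂', hlt, if_false]

theorem kernRest_comp_col (hinj : Function.Injective I) (hI : I r₂ = I r₁ + 1) (x : Fin k → ℂ)
    (y : Fin (k + 1) → ℂ) :
    kernRest q h I μ k r₁ r₂ x (y ∘ Equiv.swap r₁.castSucc r₂.castSucc) =
      kernRest q h I μ k r₁ r₂ x y := by
  unfold kernRest
  congr 1
  refine offMinor_congr (fun a h₁ h₂ => ?_) fun c h₁ h₂ => ?_
  · refine Fintype.prod_equiv (Equiv.swap r₁.castSucc r₂.castSucc) _ _ fun c => ?_
    rw [entry_swap_col hinj hI h₁ h₂, Function.comp_apply]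
  · rw [Function.comp_apply, Equiv.swap_apply_of_ne_of_ne h₁ h₂]

theorem pairFactor_swap (hinj : Function.Injective I) (hI : I r₂ = I r₁ + 1) (x : Fin k → ℂ)
    {a b : Fin k} (hab : ¬((a = r₁ ∨ a = r₂) ∧ (b = r₁ ∨ b = r₂))) :
    pairFactor q h I (x ∘ Equiv.swap r₁ r₂) a b =
      pairFactor q h I x (Equiv.swap r₁ r₂ a) (Equiv.swap r₁ r₂ b) := by
  have hlt := swap_lt_iff hinj hI (a := a) (b := b) (by simpa only [Fin.ext_iff] using hab)
  simp only [pairFactor, val_swap, hlt, Function.comp_apply]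

/-- Outside the minor the rows `r₁` and `r₂` have the same theta factors, because no value separates
`I r₁` from `I r₂`; the denominator is permuted for the same reason. -/
theorem kernRest_comp_row (hinj : Function.Injective I) (hI : I r₂ = I r₁ + 1) (x : Fin k → ℂ)
    (y : Fin (k + 1) → ℂ) :
    kernRest q h I μ k r₁ r₂ (x ∘ Equiv.swap r₁ r₂) y = kernRest q h I μ k r₁ r₂ x y := by
  unfold kernRest
  congr 1
  · refine offMinor_congr (fun a h₁ h₂ => ?_) fun c h₁ h₂ => ?_
    · simp only [Function.comp_apply, Equiv.swap_apply_of_ne_of_ne h₁ h₂]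
    · simp only [Function.comp_apply, Equiv.swap_apply_left, Equiv.swap_apply_right,
        entry_row_eq hinj hI h₁ h₂]
      ring
  · refine offMinor_congr (fun a h₁ h₂ => ?_) fun c h₁ h₂ => ?_
    · refine Fintype.prod_equiv (Equiv.swap r₁ r₂) _ _ fun c => ?_
      rw [pairFactor_swap hinj hI x (by tauto), Equiv.swap_apply_of_ne_of_ne h₁ h₂]
    · rw [pairFactor_swap hinj hI x (by tauto), pairFactor_swap hinj hI x (by tauto),
        Equiv.swap_apply_of_ne_of_ne h₁ h₂, Equiv.swap_apply_left, Equiv.swap_apply_right]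
      ring

end Step

end Exchange

/-! ### The R-matrix relation for partial weight functions. -/

section ExchangeInduction

variable {q h : ℂ} {I : ℕ → ℕ} {μ w : ℕ → ℂ} {k : ℕ}

theorem exchange_of_minors {A B F G H N₁ N₂ N₃ N₄ D P₁ P₂ : ℂ} (hD : D ≠ 0) (hP₁ : P₁ ≠ 0)
    (hP₂ : P₂ ≠ 0) (hr : A * (B * N₁ - F * P₁ * N₂) = D * (G * N₃ - H * F * N₄)) (C : ℂ) :
    A * (B / D * (N₁ / (P₁ * D) * C) - P₂ * F / -D * (N₂ / (P₂ * -D) * C)) =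
      G * (N₃ / (P₁ * D) * C) - H * F * (N₄ / (P₁ * D) * C) := by
  field_simp
  linear_combination C * hr

/-- The coefficients on the left are those produced by the exchange relation one level below, those
on the right are wanted at this level. All four kernels share one `kernRest`, so what remains is
`step_relation` with `M = g μ k / μ r` for `r = r₁, r₂`. -/
theorem kern_exchange (hq0 : q ≠ 0) (hq : ‖q‖ < 1) (hh : h ≠ 0) (hμ : ∀ i, μ i ≠ 0)
    (hinj : Function.Injective I) {r₁ r₂ : Fin k} (hI : I r₂ = I r₁ + 1) {x : Fin k → ℂ}
    (hx : ∀ a, x a ≠ 0) (h₁ : theta q (x r₁ * h / x r₂) ≠ 0)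
    (h₂ : theta q (x r₂ * h / x r₁) ≠ 0) (h₃ : theta q (x r₂ / x r₁) ≠ 0)
    {y : Fin (k + 1) → ℂ} (hy : ∀ c, y c ≠ 0) :
    theta q (y r₂.castSucc / y r₁.castSucc) *
      (theta q h * theta q (x r₂ / x r₁ * (μ r₂ / μ r₁)) / theta q (x r₂ / x r₁) *
          kern q h I (μ ∘ Equiv.swap (r₁ : ℕ) r₂) k x y -
        theta q (h * (x r₂ / x r₁)) * theta q (μ r₂ / μ r₁) / theta q (x r₁ / x r₂) *
          kern q h I (μ ∘ Equiv.swap (r₁ : ℕ) r₂) k (x ∘ Equiv.swap r₁ r₂) y) =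
    theta q h * theta q (y r₂.castSucc / y r₁.castSucc * (μ r₂ / μ r₁)) * kern q h I μ k x y -
      theta q (h * (y r₁.castSucc / y r₂.castSucc)) * theta q (μ r₂ / μ r₁) *
        kern q h I μ k x (y ∘ Equiv.swap r₁.castSucc r₂.castSucc) := by
  obtain ⟨g, hg⟩ : ∃ g, g = h ^ (1 - if I k < I r₁ then 1 else 0 : ℤ) := ⟨_, rfl⟩
  have hg0 : g ≠ 0 := hg ▸ zpow_ne_zero _ hh
  have hk : Equiv.swap (r₁ : ℕ) r₂ k = k :=
    Equiv.swap_apply_of_ne_of_ne r₁.2.ne' r₂.2.ne'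
  have hM (i : ℕ) : g * μ k / μ i ≠ 0 := div_ne_zero (mul_ne_zero hg0 (hμ k)) (hμ i)
  have hr := step_relation (h := h) hq0 hq hh (hy r₁.castSucc) (hy r₂.castSucc) (hx r₁) (hx r₂)
    (hM r₁) (hM r₂)
  have hm : g * μ k / μ r₁ / (g * μ k / μ r₂) = μ r₂ / μ r₁ := by
    have := hμ k
    have := hμ r₁
    have := hμ r₂
    field_simp
  have e1 : h * (x r₂ / x r₁) = x r₂ * h / x r₁ := by ring
  have e2 : theta q (x r₁ / x r₂) = -theta q (x r₂ / x r₁) := by rw [← inv_div, theta_inv]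
  rw [hm] at hr
  simp only [kern_eq hinj hI _ _ hg, kernRest_comp_param, kernRest_comp_row hinj hI,
    kernRest_comp_col hinj hI, Function.comp_apply, hk, Equiv.swap_apply_left,
    Equiv.swap_apply_right, e1, e2]
  exact exchange_of_minors h₃ h₁ h₂ hr _

/-- The factor of level `k` without the contribution of the roots with label `r`. -/
def lastKernRest (q h : ℂ) (I : ℕ → ℕ) (μ : ℕ → ℂ) (k : ℕ) (r : Fin k) (x : Fin k → ℂ)
    (y : Fin (k + 1) → ℂ) : ℂ :=
  (∏ a ∈ ({r} : Finset (Fin k))ᶜ, ∏ c : Fin (k + 1), entry q h I μ k a c (y c / x a)) *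
      (∏ c ∈ ({r.castSucc, Fin.last k} : Finset (Fin (k + 1)))ᶜ,
        entry q h I μ k r c (y c / x r)) /
    ∏ a : Fin k, ∏ b : Fin k, pairFactor q h I x a b

theorem kern_eq_mul_lastKernRest (r : Fin k) (x : Fin k → ℂ) (y : Fin (k + 1) → ℂ) :
    kern q h I μ k x y = entry q h I μ k r r (y r.castSucc / x r) *
      entry q h I μ k r k (y (Fin.last k) / x r) * lastKernRest q h I μ k r x y := by
  rw [kern, lastKernRest, ← prod_mul_prod_compl ({r} : Finset (Fin k)), prod_singleton,
    ← prod_mul_prod_compl ({r.castSucc, Fin.last k} : Finset (Fin (k + 1))),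
    prod_pair (Fin.castSucc_lt_last r).ne]
  simp only [Fin.val_castSucc, Fin.val_last]
  ring

theorem entry_comp_swap_last (hinj : Function.Injective I) {r : Fin k} (hI : I k = I r + 1)
    {a : Fin k} (ha : a ≠ r) (c : ℕ) (x : ℂ) :
    entry q h (I ∘ Equiv.swap (r : ℕ) k) μ k a c x = entry q h I μ k a c x := by
  have h₁ : (a : ℕ) ≠ r := fun h => ha (Fin.ext h)
  have h₂ : (a : ℕ) ≠ k := a.2.ne
  exact entry_congr _ (swap_lt_iff hinj hI (by tauto)) (swap_lt_iff hinj hI (by tauto))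

theorem pairFactor_comp_swap_last (hinj : Function.Injective I) {r : Fin k} (hI : I k = I r + 1)
    (x : Fin k → ℂ) (a b : Fin k) :
    pairFactor q h (I ∘ Equiv.swap (r : ℕ) k) x a b = pairFactor q h I x a b := by
  have ha : (a : ℕ) ≠ k := a.2.ne
  have hb : (b : ℕ) ≠ k := b.2.ne
  have hlt : (I ∘ Equiv.swap (r : ℕ) k) a < (I ∘ Equiv.swap (r : ℕ) k) b ↔ I a < I b := by
    by_cases hab : a = b
    · simp [hab]
    · refine swap_lt_iff hinj hI ?_
      rw [Fin.ext_iff] at hab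
      omega
  simp only [pairFactor, hlt]

theorem entry_swap_last (hinj : Function.Injective I) {r : Fin k} (hI : I k = I r + 1)
    {a : Fin k} (ha : a ≠ r) (c : Fin (k + 1)) (x : ℂ) :
    entry q h I μ k a (Equiv.swap r.castSucc (Fin.last k) c : Fin (k + 1)) x =
      entry q h I μ k a c x := by
  have h₁ : (a : ℕ) ≠ r := fun h => ha (Fin.ext h)
  have h₂ : (a : ℕ) ≠ k := a.2.ne
  have ha := Equiv.swap_apply_of_ne_of_ne h₁ h₂
  have hlt := swap_lt_iff hinj hI (a := c) (b := a) (by tauto)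
  rw [ha] at hlt
  have heq : Equiv.swap (r : ℕ) k c = a ↔ (c : ℕ) = a := by
    rw [← Equiv.apply_eq_iff_eq (Equiv.swap (r : ℕ) k), Equiv.swap_apply_self, ha]
  simp only [entry, val_swap, Fin.val_castSucc, Fin.val_last, hlt, heq]

theorem lastKernRest_comp_col (hinj : Function.Injective I) {r : Fin k} (hI : I k = I r + 1)
    (x : Fin k → ℂ) (y : Fin (k + 1) → ℂ) :
    lastKernRest q h I μ k r x (y ∘ Equiv.swap r.castSucc (Fin.last k)) =
      lastKernRest q h I μ k r x y := by
  unfold lastKernRest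
  congr 2
  · refine prod_congr rfl fun a ha => ?_
    rw [mem_compl, mem_singleton] at ha
    refine Fintype.prod_equiv (Equiv.swap r.castSucc (Fin.last k)) _ _ fun c => ?_
    rw [entry_swap_last hinj hI ha, Function.comp_apply]
  · refine prod_congr rfl fun c hc => ?_
    simp only [mem_compl, mem_insert, mem_singleton, not_or] at hc
    rw [Function.comp_apply, Equiv.swap_apply_of_ne_of_ne hc.1 hc.2]

theorem lastKernRest_comp_swap (hinj : Function.Injective I) {r : Fin k} (hI : I k = I r + 1)
    (x : Fin k → ℂ) (y : Fin (k + 1) → ℂ) :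
    lastKernRest q h (I ∘ Equiv.swap (r : ℕ) k) μ k r x y = lastKernRest q h I μ k r x y := by
  unfold lastKernRest
  congr 1
  · congr 1
    · refine prod_congr rfl fun a ha => prod_congr rfl fun c _ => ?_
      rw [mem_compl, mem_singleton] at ha
      rw [entry_comp_swap_last hinj hI ha]
    · refine prod_congr rfl fun c hc => ?_
      simp only [mem_compl, mem_insert, mem_singleton, not_or, Fin.ext_iff, Fin.val_castSucc,
        Fin.val_last] at hc
      have hc' := hinj.ne hc.1
      have hlt : (I ∘ Equiv.swap (r : ℕ) k) c < (I ∘ Equiv.swap (r : ℕ) k) r ↔ I c < I r := by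
        simp only [Function.comp_apply, Equiv.swap_apply_of_ne_of_ne hc.1 hc.2,
          Equiv.swap_apply_left]
        omega
      simp only [entry, hlt, hc.1, if_false]
  · simp only [pairFactor_comp_swap_last hinj hI]

/-- The label `k` is only a column at this level, so the exchange affects two entries of row `r`.
The power of `h` in the diagonal entry changes from one to zero, as `base_relation` requires. -/
theorem kern_exchange_last (hq0 : q ≠ 0) (hq : ‖q‖ < 1) (hh : h ≠ 0) (hμ : ∀ i, μ i ≠ 0)
    (hinj : Function.Injective I) {r : Fin k} (hI : I k = I r + 1) {x : Fin k → ℂ}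
    (hx : ∀ a, x a ≠ 0) {y : Fin (k + 1) → ℂ} (hy : ∀ c, y c ≠ 0) :
    theta q (h * (μ k / μ r)) * theta q (y (Fin.last k) / y r.castSucc) *
        kern q h (I ∘ Equiv.swap (r : ℕ) k) μ k x (y ∘ Equiv.swap r.castSucc (Fin.last k)) =
    theta q h * theta q (y (Fin.last k) / y r.castSucc * (μ k / μ r)) * kern q h I μ k x y -
      theta q (h * (y r.castSucc / y (Fin.last k))) * theta q (μ k / μ r) *
        kern q h I μ k x (y ∘ Equiv.swap r.castSucc (Fin.last k)) := by
  have hr := base_relation (h := h) hq0 hq hh (div_ne_zero (hμ k) (hμ r)) (hy r.castSucc)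
    (hy (Fin.last k)) (hx r)
  have hlt : I r < I k := by omega
  have hn : k ≠ r := r.2.ne'
  simp only [kern_eq_mul_lastKernRest r, lastKernRest_comp_col hinj hI,
    lastKernRest_comp_swap hinj hI]
  simp only [entry, Function.comp_apply, Equiv.swap_apply_left, Equiv.swap_apply_right,
    lt_irrefl, hlt, hlt.not_gt, hn, if_true, if_false, sub_self, sub_zero, zpow_zero, zpow_one,
    mul_one, mul_div_assoc (_ * _) (μ k), mul_div_assoc _ (μ k)]
  linear_combination lastKernRest q h I μ k r x y * hr

/-- The exchange relation (R-matrix relation) for partial weight functions. -/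
theorem partialWeight_exchange (hq0 : q ≠ 0) (hq : ‖q‖ < 1) (hh : h ≠ 0) (hμ : ∀ i, μ i ≠ 0)
    (hw : ∀ i, w i ≠ 0) (hinj : Function.Injective I) {r₁ r₂ : Fin k} (hr : r₁ < r₂)
    (hI : I r₂ = I r₁ + 1)
    (hwθ : ∀ a b, a < k → b < k → a ≠ b → theta q (w a * h / w b) ≠ 0 ∧ theta q (w b / w a) ≠ 0)
    {y : Fin k → ℂ} (hy : ∀ c, y c ≠ 0) :
    theta q (h * (μ r₂ / μ r₁)) * theta q (y r₂ / y r₁) *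
        partialWeight q h (I ∘ Equiv.swap (r₁ : ℕ) r₂) μ w k (y ∘ Equiv.swap r₁ r₂) =
    theta q h * theta q (y r₂ / y r₁ * (μ r₂ / μ r₁)) * partialWeight q h I μ w k y -
      theta q (h * (y r₁ / y r₂)) * theta q (μ r₂ / μ r₁) *
        partialWeight q h I μ w k (y ∘ Equiv.swap r₁ r₂) := by
  induction k with
  | zero => exact r₁.elim0
  | succ k ih =>
    obtain ⟨s₁, rfl⟩ : ∃ s₁ : Fin k, r₁ = s₁.castSucc :=
      ⟨r₁.castPred (hr.trans_le (Fin.le_last _)).ne, by simp⟩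
    induction r₂ using Fin.lastCases with
    | last =>
      rw [Fin.val_last, Fin.val_castSucc] at *
      simp only [partialWeight, mul_sum, ← sum_sub_distrib]
      refine sum_congr rfl fun τ _ => ?_
      -- The lower levels see only the first of the two times, so their order pattern is unaffected.
      have hc : partialWeight q h (I ∘ Equiv.swap (s₁ : ℕ) k) μ w k (fun a => w (τ a)) =
          partialWeight q h I μ w k (fun a => w (τ a)) := by
        refine partialWeight_congr _ fun a b ha hb => ?_
        by_cases hab : a = b
        · simp [hab]
        · exact swap_lt_iff hinj hI (by omega)
      have he := kern_exchange_last (h := h) hq0 hq hh hμ hinj hI (x := fun a => w (τ a))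
        (fun a => hw _) hy
      rw [hc]
      linear_combination partialWeight q h I μ w k (fun a => w (τ a)) * he
    | cast s₂ =>
      have hs : s₁ < s₂ := hr
      rw [Fin.val_castSucc, Fin.val_castSucc] at *
      have IH := fun (τ : Equiv.Perm (Fin k)) => ih (r₁ := s₁) (r₂ := s₂) hs hI
        (fun a b ha hb hab => hwθ a b (by omega) (by omega) hab) (y := fun a => w (τ a))
        fun c => hw _
      have hk (τ : Equiv.Perm (Fin k)) := kern_exchange hq0 hq hh hμ hinj hI
        (x := fun a => w (τ a)) (fun a => hw _)
        (hwθ _ _ (by omega) (by omega) fun e => hs.ne (τ.injective (Fin.ext e))).1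
        (hwθ _ _ (by omega) (by omega) fun e => hs.ne' (τ.injective (Fin.ext e))).1
        (hwθ _ _ (by omega) (by omega) fun e => hs.ne (τ.injective (Fin.ext e))).2 hy
      have hD (τ : Equiv.Perm (Fin k)) : theta q (w (τ s₂) / w (τ s₁)) ≠ 0 :=
        (hwθ _ _ (by omega) (by omega) fun e => hs.ne (τ.injective (Fin.ext e))).2
      have hsum (f : Equiv.Perm (Fin k) → ℂ) : ∑ τ, f τ = ∑ τ, f (τ * Equiv.swap s₁ s₂) :=
        (Equiv.sum_comp (Equiv.mulRight (Equiv.swap s₁ s₂)) f).symm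
      have hcomp (τ : Equiv.Perm (Fin k)) : (fun a => w ((τ * Equiv.swap s₁ s₂) a : Fin k)) =
          (fun a => w (τ a)) ∘ Equiv.swap s₁ s₂ := rfl
      set m := μ s₂ / μ s₁
      -- The sum is reindexed by `τ ↦ τ * swap`, the kernel is relabelled, and the inductive
      -- relation expands the lower weight. A second reindexing of one half makes the lower weight
      -- at `τ` a common factor, so that `kern_exchange` applies term by term.
      have hL : theta q (h * m) * partialWeight q h (I ∘ Equiv.swap (s₁ : ℕ) s₂) μ w (k + 1)
            (y ∘ Equiv.swap s₁.castSucc s₂.castSucc) =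
          ∑ τ : Equiv.Perm (Fin k), partialWeight q h I μ w k (fun a => w (τ a)) *
            (theta q h * theta q (w (τ s₂) / w (τ s₁) * m) / theta q (w (τ s₂) / w (τ s₁)) *
              kern q h I (μ ∘ Equiv.swap (s₁ : ℕ) s₂) k (fun a => w (τ a)) y -
            theta q (h * (w (τ s₂) / w (τ s₁))) * theta q m / theta q (w (τ s₁) / w (τ s₂)) *
              kern q h I (μ ∘ Equiv.swap (s₁ : ℕ) s₂) k ((fun a => w (τ a)) ∘ Equiv.swap s₁ s₂)
                y) := by
        simp only [mul_sub, sum_sub_distrib]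
        rw [hsum fun τ => partialWeight q h I μ w k (fun a => w (τ a)) *
            (theta q (h * (w (τ s₂) / w (τ s₁))) * theta q m / theta q (w (τ s₁) / w (τ s₂)) *
              kern q h I (μ ∘ Equiv.swap (s₁ : ℕ) s₂) k ((fun a => w (τ a)) ∘ Equiv.swap s₁ s₂)
                y), ← sum_sub_distrib, partialWeight, hsum, mul_sum]
        refine sum_congr rfl fun τ _ => ?_
        have hxx : ((fun a => w (τ a)) ∘ Equiv.swap s₁ s₂) ∘ Equiv.swap s₁ s₂ =
            fun a => w (τ a) := by
          funext a
          simp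
        rw [hcomp, kern_comp_swap, hxx]
        simp only [Equiv.Perm.mul_apply, Equiv.swap_apply_left, Equiv.swap_apply_right]
        have hV : theta q (h * m) * partialWeight q h (I ∘ Equiv.swap (s₁ : ℕ) s₂) μ w k
              ((fun a => w (τ a)) ∘ Equiv.swap s₁ s₂) =
            (theta q h * theta q (w (τ s₂) / w (τ s₁) * m) *
                partialWeight q h I μ w k (fun a => w (τ a)) -
              theta q (h * (w (τ s₁) / w (τ s₂))) * theta q m *
                partialWeight q h I μ w k ((fun a => w (τ a)) ∘ Equiv.swap s₁ s₂)) /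
              theta q (w (τ s₂) / w (τ s₁)) := by
          rw [eq_div_iff (hD τ)]
          linear_combination IH τ
        linear_combination kern q h I (μ ∘ Equiv.swap (s₁ : ℕ) s₂) k (fun a => w (τ a)) y * hV
      rw [mul_right_comm, hL, sum_mul, partialWeight, partialWeight, mul_sum, mul_sum,
        ← sum_sub_distrib]
      refine sum_congr rfl fun τ _ => ?_
      linear_combination partialWeight q h I μ w k (fun a => w (τ a)) * hk τ

end ExchangeInduction

/-! ### Chern roots labelled by times instead of sorted positions. -/

section Labelling

variable {n : ℕ} {q h : ℂ}

/-- The extension of a tuple of parameters by the value `1`. -/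
def extendParam (f : Fin n → ℂ) (m : ℕ) : ℂ := if hm : m < n then f ⟨m, hm⟩ else 1

/-- The extension of a permutation of `Fin n` by the identity. -/
def extendPerm (I : Equiv.Perm (Fin n)) (m : ℕ) : ℕ := if hm : m < n then I ⟨m, hm⟩ else m

@[simp]
theorem extendParam_of_lt (f : Fin n → ℂ) {m : ℕ} (hm : m < n) :
    extendParam f m = f ⟨m, hm⟩ := dif_pos hm

@[simp]
theorem extendParam_val (f : Fin n → ℂ) (m : Fin n) : extendParam f m = f m :=
  extendParam_of_lt f m.2

@[simp]
theorem extendPerm_of_lt (I : Equiv.Perm (Fin n)) {m : ℕ} (hm : m < n) :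
    extendPerm I m = I ⟨m, hm⟩ := dif_pos hm

@[simp]
theorem extendPerm_val (I : Equiv.Perm (Fin n)) (m : Fin n) : extendPerm I m = I m :=
  extendPerm_of_lt I m.2

theorem extendParam_ne_zero {f : Fin n → ℂ} (hf : ∀ i, f i ≠ 0) (m : ℕ) :
    extendParam f m ≠ 0 := by
  rw [extendParam]
  split_ifs
  exacts [hf _, one_ne_zero]

theorem extendPerm_injective (I : Equiv.Perm (Fin n)) : Function.Injective (extendPerm I) := by
  intro a b hab
  unfold extendPerm at hab
  split_ifs at hab with ha hb hb
  · simpa using I.injective (Fin.ext hab)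
  · omega
  · omega
  · exact hab

variable (q h) in
/-- The restriction matrix, computed with the Chern roots labelled by times. -/
def fixedWeight (I J : Equiv.Perm (Fin n)) (z μ : Fin n → ℂ) : ℂ :=
  partialWeight q h (extendPerm I) (extendParam μ) (extendParam (z ∘ J)) n (z ∘ I)

theorem extendRoots_castSucc (t : ChernRoots n) (z : Fin n → ℂ) (k : Fin n) :
    extendRoots t z k.castSucc = t k :=
  Fin.snoc_castSucc (α := fun k : Fin (n + 1) => Fin k → ℂ) z t k

theorem extendRoots_last (t : ChernRoots n) (z : Fin n → ℂ) :
    extendRoots t z (Fin.last n) = z :=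
  Fin.snoc_last (α := fun k : Fin (n + 1) => Fin k → ℂ) z t

theorem extendRoots_eq_self (t : ChernRoots (n + 1)) (k : Fin (n + 1)) :
    extendRoots (fun j : Fin n => t j.castSucc) (t (Fin.last n)) k = t k := by
  induction k using Fin.lastCases with
  | last => exact extendRoots_last _ _
  | cast k => exact extendRoots_castSucc _ _ k

/-- Splitting off the permutation of the top group of roots reproduces the recursive definition,
with that group serving as the last level of what remains. -/
theorem sum_prod_kern (I : ℕ → ℕ) (μ w : ℕ → ℂ) (n : ℕ) (y : Fin n → ℂ) :
    ∑ τ : (k : Fin n) → Equiv.Perm (Fin k), ∏ k : Fin n,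
      kern q h I μ k (fun a => w (τ k a)) (extendRoots (fun k a => w (τ k a)) y k.succ) =
    partialWeight q h I μ w n y := by
  induction n with
  | zero => simp [partialWeight]
  | succ n ih =>
    rw [← (Fin.snocEquiv fun k : Fin (n + 1) => Equiv.Perm (Fin k)).sum_comp,
      Fintype.sum_prod_type, partialWeight]
    refine sum_congr rfl fun σ _ => ?_
    rw [← ih, sum_mul]
    refine sum_congr rfl fun τ _ => ?_
    rw [Fin.prod_univ_castSucc]
    set τ' := Fin.snocEquiv (fun k : Fin (n + 1) => Equiv.Perm (Fin k)) (σ, τ) with hτ'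
    have h1 (k : Fin n) : τ' k.castSucc = τ k :=
      Fin.snoc_castSucc (α := fun k : Fin (n + 1) => Equiv.Perm (Fin k)) σ τ k
    have h2 : τ' (Fin.last n) = σ :=
      Fin.snoc_last (α := fun k : Fin (n + 1) => Equiv.Perm (Fin k)) σ τ
    have h3 (k : Fin n) : extendRoots (fun k a => w (τ' k a)) y k.castSucc.succ =
        extendRoots (fun k a => w (τ k a)) (fun a => w (σ a)) k.succ := by
      have h4 := extendRoots_eq_self (fun k a => w (τ' k a)) k.succ
      simp only [h1, h2] at h4
      refine Eq.trans ?_ h4.symm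
      exact extendRoots_castSucc _ _ k.succ
    have h5 : extendRoots (fun k a => w (τ' k a)) y (Fin.last n).succ = y :=
      extendRoots_last _ _
    refine congrArg₂ (· * ·) (prod_congr rfl fun k _ => ?_) ?_
    · rw [h3, h1]
      rfl
    · rw [h2, h5]
      rfl

/-- The position in increasing order of the elements `I 0, …, I (k - 1)`. -/
theorem exists_sortedIndex_eq (I : Equiv.Perm (Fin n)) (k : Fin (n + 1)) :
    ∃ ρ : Equiv.Perm (Fin k), ∀ m : Fin k,
      sortedIndex I k (ρ m) = I ⟨m, m.2.trans_le k.is_le⟩ := by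
  have hmem (m : Fin k) : I ⟨m, m.2.trans_le k.is_le⟩ ∈ initialSet I k := by
    simp [initialSet]
  let f : Fin k → Fin k := fun m =>
    ((initialSet I k).orderIsoOfFin (card_initialSet I k)).symm ⟨_, hmem m⟩
  have hf : Function.Injective f := by
    intro a b hab
    have := ((initialSet I k).orderIsoOfFin (card_initialSet I k)).symm.injective hab
    simpa [Fin.ext_iff] using this
  refine ⟨Equiv.ofBijective f (Finite.injective_iff_bijective.mp hf), fun m => ?_⟩
  rw [Equiv.ofBijective_apply, sortedIndex, ← coe_orderIsoOfFin_apply]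
  simp [f]

theorem sortedIndex_last (I : Equiv.Perm (Fin n)) (m : Fin n) :
    sortedIndex I (Fin.last n) m = m := by
  have h := orderEmbOfFin_unique (card_initialSet I (Fin.last n)) (f := fun m : Fin n => m)
    (fun m => by simp [initialSet]) strictMono_id
  exact (congrFun h m).symm

/-- Sorted positions and times differ by a permutation at each level. For the Chern roots these
permutations are absorbed by the symmetrization; at level `n` they turn `z` into `z ∘ I`. -/
theorem restrictionMatrix_eq (I J : Equiv.Perm (Fin n)) (z μ : Fin n → ℂ) :
    restrictionMatrix q h I J z μ = fixedWeight q h I J z μ := by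
  choose ρI hρI using exists_sortedIndex_eq I
  choose ρJ hρJ using exists_sortedIndex_eq J
  rw [fixedWeight, ← sum_prod_kern, restrictionMatrix, weight]
  let πI (k : Fin n) : Equiv.Perm (Fin k) := ρI k.castSucc
  let πJ (k : Fin n) : Equiv.Perm (Fin k) := ρJ k.castSucc
  -- Each `τ k` is replaced by `πJ k * τ k * (πI k)⁻¹`: back to times through `I`, then to sorted
  -- positions through `J`.
  let e : ((k : Fin n) → Equiv.Perm (Fin k)) ≃ ((k : Fin n) → Equiv.Perm (Fin k)) :=
    Equiv.piCongrRight fun k => (Equiv.mulLeft (πJ k)).trans (Equiv.mulRight (πI k)⁻¹)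
  rw [← e.sum_comp]
  refine sum_congr rfl fun τ _ => ?_
  have he (k : Fin n) (m : Fin k) : (e τ k) (ρI k.castSucc m) = ρJ k.castSucc (τ k m) := by
    change (πJ k * τ k * (πI k)⁻¹) (πI k m) = πJ k (τ k m)
    simp
  have ht (k : Fin n) (m : Fin k) : fixedPointRoots z J k ((e τ k) (ρI k.castSucc m)) =
      extendParam (z ∘ J) (τ k m) := by
    rw [he, fixedPointRoots]
    rw [hρJ, extendParam_of_lt _ ((τ k m).2.trans k.2)]
    rfl
  have hx (j : Fin (n + 1)) (m : Fin j) :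
      extendRoots (fun k a => fixedPointRoots z J k ((e τ k) a)) z j (ρI j m) =
        extendRoots (fun k a => extendParam (z ∘ J) (τ k a)) (z ∘ I) j m := by
    induction j using Fin.lastCases with
    | last =>
      rw [extendRoots_last, extendRoots_last]
      have := hρI (Fin.last n) m
      rw [sortedIndex_last] at this
      exact congrArg z this
    | cast j =>
      rw [extendRoots_castSucc, extendRoots_castSucc]
      exact ht j m
  rw [preWeight]
  refine prod_congr rfl fun k _ => ?_
  rw [kern]
  congr 1
  · refine (Fintype.prod_equiv (ρI k.castSucc) _ _ fun a =>
      Fintype.prod_equiv (ρI k.succ) _ _ fun c => ?_).symm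
    rw [hx, hx, extendRoots_castSucc, psi, entry]
    have ha := a.2
    have hc := c.2
    simp only [Fin.val_castSucc, Fin.val_succ] at ha hc
    have hk := k.2
    simp only [hρI, pFun, Equiv.symm_apply_apply, EmbeddingLike.apply_eq_iff_eq, Fin.mk.injEq,
      extendPerm_of_lt I (show (a : ℕ) < n by omega), extendPerm_of_lt I (show (c : ℕ) < n by omega),
      extendPerm_val, extendParam_val, extendParam_of_lt μ (show (a : ℕ) < n by omega),
      Fin.lt_def]
  · refine (Fintype.prod_equiv (ρI k.castSucc) _ _ fun a => ?_).symm
    have hI (b : Fin k) : Ioi b = univ.filter fun a => b < a := by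
      ext
      simp
    rw [hI, prod_filter]
    refine Fintype.prod_equiv (ρI k.castSucc) _ _ fun b => ?_
    have hlt : (ρI k.castSucc a < ρI k.castSucc b) ↔
        extendPerm I (a : ℕ) < extendPerm I (b : ℕ) := by
      rw [← (sortedIndex I k.castSucc).lt_iff_lt, hρI, hρI, extendPerm_of_lt I (a.2.trans k.2),
        extendPerm_of_lt I (b.2.trans k.2), Fin.lt_def]
    simp only [pairFactor]
    rw [ht, ht]
    simp only [← hlt]

end Labelling

/-! ### Triangularity and diagonal entries. -/

section Generic

variable {n : ℕ} {q h : ℂ}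

section Support

variable {I J : ℕ → ℕ} {μ Z : ℕ → ℂ} {k : ℕ}

theorem kern_eq_zero {x : Fin k → ℂ} {y : Fin (k + 1) → ℂ} {a : Fin k} {c : Fin (k + 1)}
    (hx : x a ≠ 0) (hlt : I a < I c) (hxy : y c = x a) : kern q h I μ k x y = 0 := by
  have he : entry q h I μ k a c (y c / x a) = 0 := by
    have hca : (c : ℕ) ≠ a := by
      intro h
      rw [h] at hlt
      exact lt_irrefl _ hlt
    rw [entry, if_neg hlt.not_gt, if_neg hca, hxy, div_self hx, theta_one]
  rw [kern, prod_eq_zero (mem_univ a) (prod_eq_zero (mem_univ c) he), zero_div]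

/-- Each `J (τ a)` is some `I c`; if it exceeded `I a`, a factor `θ(1)` would occur. Thus all values
of `J` are bounded by those of `I`, while the total sums agree, so every inequality is an equality.
-/
theorem eq_of_kern_ne_zero (hI : Function.Injective I) (hJ : Function.Injective J)
    (hZ : ∀ i, Z i ≠ 0) (him : (range (k + 1)).image I = (range (k + 1)).image J)
    (hk : J k ≤ I k) {τ : Equiv.Perm (Fin k)}
    (hne : kern q h I μ k (fun a => Z (J (τ a))) (fun c => Z (I c)) ≠ 0) :
    (∀ a, J (τ a) = I a) ∧ J k = I k := by
  have hle (a : Fin k) : J (τ a) ≤ I a := by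
    by_contra! hlt
    have hmem : J (τ a) ∈ (range (k + 1)).image I := by
      rw [him]
      exact mem_image_of_mem _ (mem_range.mpr (by omega))
    obtain ⟨c, hc, hcJ⟩ := mem_image.mp hmem
    refine hne (kern_eq_zero (a := a) (c := ⟨c, mem_range.mp hc⟩) (hZ _) ?_ ?_)
    · simpa [hcJ] using hlt
    · simp [hcJ]
  have hsum : ∑ m ∈ range (k + 1), I m = ∑ m ∈ range (k + 1), J m := by
    rw [← sum_image (f := fun m => m) hI.injOn, him, sum_image (f := fun m => m) hJ.injOn]
  rw [sum_range_succ, sum_range_succ, sum_range, sum_range,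
    ← Equiv.sum_comp τ fun a : Fin k => J a] at hsum
  have hle' : ∑ a, J (τ a) ≤ ∑ a : Fin k, I a := sum_le_sum fun a _ => hle a
  refine ⟨fun a => ?_, by omega⟩
  exact (sum_eq_sum_iff_of_le fun a _ => hle a).mp (by omega) a (mem_univ a)

theorem eq_of_partialWeight_ne_zero (hI : Function.Injective I) (hJ : Function.Injective J)
    (hZ : ∀ i, Z i ≠ 0)
    (him : (range k).image I = (range k).image J)
    (hJI : ∀ m < k, (range (m + 1)).image I = (range (m + 1)).image J → J m ≤ I m)
    (hne : partialWeight q h I μ (fun m => Z (J m)) k (fun m => Z (I m)) ≠ 0) :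
    ∀ m < k, I m = J m := by
  induction k with
  | zero => simp
  | succ k ih =>
    rw [partialWeight] at hne
    obtain ⟨τ, -, hτ⟩ := exists_ne_zero_of_sum_ne_zero hne
    obtain ⟨h₁, h₂⟩ := eq_of_kern_ne_zero hI hJ hZ him (hJI k (by omega) him)
      (right_ne_zero_of_mul hτ)
    have him' : (range k).image I = (range k).image J := by
      rw [range_add_one, image_insert, image_insert, h₂] at him
      have hnI : I k ∉ (range k).image I := by simp [hI.eq_iff]
      have hnJ : I k ∉ (range k).image J := by simp [← h₂, hJ.eq_iff]
      rw [← erase_insert hnI, him, erase_insert hnJ]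
    have hw : (fun a => Z (J (τ a))) = fun a : Fin k => Z (I a) := by
      funext a
      rw [h₁]
    have hl := left_ne_zero_of_mul hτ
    rw [hw] at hl
    intro m hm
    rcases Nat.lt_succ_iff_lt_or_eq.mp hm with hm | rfl
    · exact ih him' (fun m hm => hJI m (by omega)) hl m hm
    · exact h₂.symm

theorem partialWeight_self (hI : Function.Injective I) (hZ : ∀ i, Z i ≠ 0) :
    partialWeight q h I μ (fun m => Z (I m)) k (fun m => Z (I m)) =
      ∏ m ∈ range k, kern q h I μ m (fun a => Z (I a)) (fun c => Z (I c)) := by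
  induction k with
  | zero => rfl
  | succ k ih =>
    rw [partialWeight, prod_range_succ, ← ih, sum_eq_single 1]
    · simp
    · intro τ _ hτ
      by_contra hne
      have h₁ := (eq_of_kern_ne_zero hI hI hZ rfl le_rfl (right_ne_zero_of_mul hne)).1
      exact hτ (Equiv.ext fun a => Fin.ext (hI (h₁ a)))
    · simp

/-- At its own fixed point the entries between distinct old labels cancel the denominator, after
transposing the indices of the factors with `h`. The diagonal entries and the column `k` remain. -/
theorem kern_self (hI : Function.Injective I) (w : ℕ → ℂ) (hw : ∀ i, w i ≠ 0)
    (hwθ : ∀ a b, a < k → b < k → a ≠ b → theta q (w a * h / w b) ≠ 0 ∧ theta q (w b / w a) ≠ 0) :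
    kern q h I μ k (fun a => w a) (fun c => w c) =
      ∏ a : Fin k, if I k < I a then theta q (μ k / μ a) * theta q (h * (w k / w a))
        else theta q (h * (μ k / μ a)) * theta q (w k / w a) := by
  have hne : ∏ a : Fin k, ∏ b : Fin k, pairFactor q h I (fun a => w a) a b ≠ 0 := by
    refine prod_ne_zero_iff.mpr fun a _ => prod_ne_zero_iff.mpr fun b _ => ?_
    rw [pairFactor]
    split_ifs with hab
    · have hab' : (a : ℕ) ≠ b := by
        intro e
        rw [e] at hab
        exact lt_irrefl _ hab
      have := hwθ a b a.2 b.2 hab'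
      exact mul_ne_zero this.1 this.2
    · exact one_ne_zero
  rw [kern, div_eq_iff hne]
  have h₁ : ∏ a : Fin k, ∏ b : Fin k, pairFactor q h I (fun a => w a) a b =
      ∏ a : Fin k, ∏ b : Fin k, ((if I b < I a then theta q (h * (w b / w a)) else 1) *
        if I a < I b then theta q (w b / w a) else 1) := by
    simp only [prod_mul_distrib]
    rw [prod_comm (f := fun a b : Fin k => if I b < I a then theta q (h * (w b / w a)) else 1),
      ← prod_mul_distrib]
    refine prod_congr rfl fun a _ => ?_
    rw [← prod_mul_distrib]
    refine prod_congr rfl fun b _ => ?_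
    rw [pairFactor]
    split_ifs
    · rw [mul_comm (w a), mul_div_assoc]
    · simp
  rw [h₁, ← prod_mul_distrib]
  refine prod_congr rfl fun a _ => ?_
  rw [Fin.prod_univ_castSucc, ← mul_prod_erase univ _ (mem_univ a),
    ← mul_prod_erase univ _ (mem_univ a)]
  have h₂ : ∏ c ∈ univ.erase a,
      entry q h I μ k a (c.castSucc : Fin (k + 1)) (w (c.castSucc : Fin (k + 1)) / w a) =
      ∏ b ∈ univ.erase a, ((if I b < I a then theta q (h * (w b / w a)) else 1) *
        if I a < I b then theta q (w b / w a) else 1) := by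
    refine prod_congr rfl fun c hc => ?_
    have hca : (c : ℕ) ≠ a := fun e => ne_of_mem_erase hc (Fin.ext e)
    have hIca := hI.ne hca
    rw [entry, Fin.val_castSucc]
    split_ifs <;> first | omega | simp
  rw [h₂]
  have hka : k ≠ a := a.2.ne'
  simp only [entry, Fin.val_castSucc, Fin.val_last, lt_irrefl, if_false, if_true, hka,
    div_self (hw _), one_mul]
  split_ifs <;> simp only [sub_self, sub_zero, zpow_zero, zpow_one, one_mul, mul_div_assoc] <;> ring

end Support

/-- Parameters that are generic with respect to the theta factors of the restriction matrix. -/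
def IsGeneric (q h : ℂ) (z : Fin n → ℂ) : Prop :=
  (∀ i, z i ≠ 0) ∧ ∀ i j, i ≠ j → theta q (z i / z j) ≠ 0 ∧ theta q (h * (z i / z j)) ≠ 0

theorem IsGeneric.comp {z : Fin n → ℂ} (hz : IsGeneric q h z) (σ : Equiv.Perm (Fin n)) :
    IsGeneric q h (z ∘ σ) :=
  ⟨fun _ => hz.1 _, fun _ _ hij => hz.2 _ _ (σ.injective.ne hij)⟩

theorem IsGeneric.inv {z : Fin n → ℂ} (hz : IsGeneric q h z) : IsGeneric q h z⁻¹ := by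
  refine ⟨fun i => inv_ne_zero (hz.1 i), fun i j hij => ?_⟩
  have := hz.2 j i hij.symm
  simp only [Pi.inv_apply, inv_div_inv]
  exact this

theorem IsGeneric.extend {z : Fin n → ℂ} (hz : IsGeneric q h z) (a b : ℕ) (ha : a < n)
    (hb : b < n) (hab : a ≠ b) : theta q (extendParam z a * h / extendParam z b) ≠ 0 ∧
      theta q (extendParam z b / extendParam z a) ≠ 0 := by
  rw [extendParam_of_lt _ ha, extendParam_of_lt _ hb, mul_comm, mul_div_assoc]
  exact ⟨(hz.2 ⟨a, ha⟩ ⟨b, hb⟩ (by simpa using hab)).2,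
    (hz.2 ⟨b, hb⟩ ⟨a, ha⟩ (by simpa using hab.symm)).1⟩

theorem extendParam_comp (z : Fin n → ℂ) (J : Equiv.Perm (Fin n)) :
    extendParam (z ∘ J) = fun m => extendParam z (extendPerm J m) := by
  funext m
  by_cases hm : m < n
  · simp [hm]
  · simp [extendParam, extendPerm, hm]

/-- In either case, equality of the sets of the first `m + 1` values gives `J m ≤ I m`: the identity
has the maximum of its initial set at time `m`, the longest permutation the minimum. Then the
descent through the levels forces `I = J`. -/
theorem fixedWeight_eq_zero {I J : Equiv.Perm (Fin n)} {z μ : Fin n → ℂ} (hz : ∀ i, z i ≠ 0)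
    (hIJ : I ≠ J) (hJI : (∀ m, I m = m) ∨ ∀ m, J m = Fin.rev m) :
    fixedWeight q h I J z μ = 0 := by
  by_contra hne
  apply hIJ
  have himI (K : Equiv.Perm (Fin n)) : (range n).image (extendPerm K) = range n := by
    refine eq_of_subset_of_card_le (fun m hm => ?_) ?_
    · obtain ⟨a, ha, rfl⟩ := mem_image.mp hm
      rw [extendPerm_of_lt K (mem_range.mp ha)]
      exact mem_range.mpr (Fin.is_lt _)
    · rw [card_image_of_injective _ (extendPerm_injective K)]
  have hy : (z ∘ I : Fin n → ℂ) = fun m : Fin n => extendParam z (extendPerm I m) := by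
    funext m
    simp
  rw [fixedWeight, extendParam_comp, hy] at hne
  have h₀ := eq_of_partialWeight_ne_zero (extendPerm_injective I) (extendPerm_injective J)
    (extendParam_ne_zero hz) (by rw [himI, himI]) ?_ hne
  · ext m
    simpa using h₀ m m.2
  · intro m hm him
    rcases hJI with hI | hJ
    · have hmem : extendPerm J m ∈ (range (m + 1)).image (extendPerm I) := by
        rw [him]
        exact mem_image_of_mem _ (by simp)
      obtain ⟨a, ha, haJ⟩ := mem_image.mp hmem
      have ha' := mem_range.mp ha
      rw [← haJ, extendPerm_of_lt I (by omega), extendPerm_of_lt I hm, hI, hI]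
      exact Nat.lt_succ_iff.mp ha'
    · have hmem : extendPerm I m ∈ (range (m + 1)).image (extendPerm J) := by
        rw [← him]
        exact mem_image_of_mem _ (by simp)
      obtain ⟨a, ha, haJ⟩ := mem_image.mp hmem
      have ha' := mem_range.mp ha
      rw [extendPerm_of_lt J (by omega), hJ] at haJ
      rw [extendPerm_of_lt J hm, ← haJ, hJ]
      simp only [Fin.val_rev]
      omega

theorem fixedWeight_self {I : Equiv.Perm (Fin n)} {z μ : Fin n → ℂ} (hz : IsGeneric q h z) :
    fixedWeight q h I I z μ = ∏ k : Fin n, ∏ a ∈ Iio k,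
      if I k < I a then theta q (μ k / μ a) * theta q (h * (z (I k) / z (I a)))
        else theta q (h * (μ k / μ a)) * theta q (z (I k) / z (I a)) := by
  have hy : (z ∘ I : Fin n → ℂ) = fun m : Fin n => extendParam z (extendPerm I m) := by
    funext m
    simp
  rw [fixedWeight, extendParam_comp, hy, partialWeight_self (extendPerm_injective I)
    (extendParam_ne_zero hz.1), prod_range]
  refine prod_congr rfl fun k _ => ?_
  have hwθ := (hz.comp I).extend
  rw [extendParam_comp] at hwθ
  rw [kern_self (extendPerm_injective I) (fun m => extendParam z (extendPerm I m))
    (fun _ => extendParam_ne_zero hz.1 _)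
    fun a b ha hb => hwθ a b (ha.trans k.2) (hb.trans k.2)]
  rw [← prod_range fun a => if extendPerm I k < extendPerm I a then
      theta q (extendParam μ k / extendParam μ a) *
        theta q (h * (extendParam z (extendPerm I k) / extendParam z (extendPerm I a)))
    else theta q (h * (extendParam μ k / extendParam μ a)) *
      theta q (extendParam z (extendPerm I k) / extendParam z (extendPerm I a)),
    ← Nat.Iio_eq_range, ← Fin.map_valEmbedding_Iio, prod_map]
  simp

end Generic

/-! ### Left and right recursions, and mirror symmetry for generic parameters. -/

section Recursions

variable {n : ℕ} {q h : ℂ} {z μ : Fin n → ℂ}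

theorem comp_swap_comp_swap {α : Type*} (f : Fin n → α) (a b : Fin n) :
    (f ∘ Equiv.swap a b) ∘ Equiv.swap a b = f := by
  funext i
  simp

theorem swap_mul_swap_mul (I : Equiv.Perm (Fin n)) (a b : Fin n) :
    Equiv.swap a b * (Equiv.swap a b * I) = I := by
  rw [← mul_assoc, Equiv.swap_mul_self, one_mul]

theorem fixedWeight_exchange_of_lt (hq0 : q ≠ 0) (hq : ‖q‖ < 1) (hh : h ≠ 0)
    (hz : IsGeneric q h z) (hμ : ∀ i, μ i ≠ 0) {a b : Fin n} (hab : (b : ℕ) = a + 1)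
    (I J : Equiv.Perm (Fin n)) (hI : I⁻¹ a < I⁻¹ b) :
    theta q (h * (μ (I⁻¹ b) / μ (I⁻¹ a))) * theta q (z b / z a) *
        fixedWeight q h (Equiv.swap a b * I) J z μ =
      theta q h * theta q (z b / z a * (μ (I⁻¹ b) / μ (I⁻¹ a))) * fixedWeight q h I J z μ -
        theta q (h * (z a / z b)) * theta q (μ (I⁻¹ b) / μ (I⁻¹ a)) *
          fixedWeight q h I (Equiv.swap a b * J) (z ∘ Equiv.swap a b) μ := by
  have hswap : Equiv.swap a b * I = I * Equiv.swap (I⁻¹ a) (I⁻¹ b) := by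
    rw [Equiv.mul_swap_eq_swap_mul]
    simp
  have h₁ : extendPerm (Equiv.swap a b * I) =
      extendPerm I ∘ Equiv.swap ((I⁻¹ a : Fin n) : ℕ) (I⁻¹ b : Fin n) := by
    rw [hswap]
    funext m
    by_cases hm : m < n
    · obtain ⟨m, rfl⟩ : ∃ m' : Fin n, m = m' := ⟨⟨m, hm⟩, rfl⟩
      rw [Function.comp_apply, ← val_swap, extendPerm_val, extendPerm_val, Equiv.Perm.mul_apply]
    · rw [Function.comp_apply, Equiv.swap_apply_of_ne_of_ne (by omega) (by omega)]
      simp [extendPerm, hm]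
  have h₂ : z ∘ ⇑(Equiv.swap a b * I) = (z ∘ I) ∘ Equiv.swap (I⁻¹ a) (I⁻¹ b) := by
    rw [hswap]
    rfl
  -- Exchanging `z` and `J` together leaves the roots unchanged; only the top-level variables `z ∘
  -- I` are permuted.
  have h₃ : (z ∘ Equiv.swap a b) ∘ ⇑(Equiv.swap a b * J) = z ∘ J := by
    funext i
    simp
  have h₄ : (z ∘ Equiv.swap a b) ∘ I = z ∘ ⇑(Equiv.swap a b * I) := rfl
  have he := partialWeight_exchange (h := h) (μ := extendParam μ) (w := extendParam (z ∘ J))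
    hq0 hq hh (extendParam_ne_zero hμ) (extendParam_ne_zero fun _ => hz.1 _)
    (extendPerm_injective I) hI (by simpa using hab) (hz.comp J).extend (y := z ∘ I)
    (fun _ => hz.1 _)
  have hia (c : Fin n) : I (I⁻¹ c) = c := by simp
  simp only [Function.comp_apply, hia, extendParam_val] at he
  rw [fixedWeight, fixedWeight, fixedWeight, h₃, h₄, h₂, h₁]
  exact he

/-- The specialization `c = a⁻¹` of the three-term relation. It plays the role of unitarity of the
R-matrix and allows the exchange relation to be inverted. -/
theorem theta_quadratic (hq0 : q ≠ 0) (hq : ‖q‖ < 1) (hh : h ≠ 0) {Z m : ℂ} (hZ : Z ≠ 0)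
    (hm : m ≠ 0) :
    theta q h * theta q h * theta q (Z * m⁻¹) * theta q (Z * m) +
        theta q (h * Z⁻¹) * theta q (h * Z) * theta q m * theta q m =
      theta q Z * theta q Z * theta q (h * m) * theta q (h * m⁻¹) := by
  have h0 := theta_three_term hq0 hq (s := h * Z) (a := m) (b := Z) (c := m⁻¹)
    (mul_ne_zero hh hZ) hm hZ (inv_ne_zero hm)
  have e1 : h * Z / (m * Z ^ 2 * m⁻¹) = h * Z⁻¹ := by field_simp
  have e2 : h * Z / Z = h := by field_simp
  have e3 : h * Z / (m * Z * m⁻¹) = h := by field_simp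
  have e4 : h * Z / (Z * m⁻¹) = h * m := by field_simp
  have e5 : m * Z * m⁻¹ = Z := by field_simp
  have e6 : h * Z / (m * Z) = h * m⁻¹ := by field_simp
  rw [e1, e2, e3, e4, e5, e6, theta_inv, mul_comm m Z] at h0
  linear_combination -h0

/-- The R-matrix relation for the restriction matrix. -/
theorem fixedWeight_exchange (hq0 : q ≠ 0) (hq : ‖q‖ < 1) (hh : h ≠ 0)
    (hz : IsGeneric q h z) (hμ : IsGeneric q h μ) {a b : Fin n} (hab : (b : ℕ) = a + 1)
    (I J : Equiv.Perm (Fin n)) :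
    theta q (h * (μ (I⁻¹ b) / μ (I⁻¹ a))) * theta q (z b / z a) *
        fixedWeight q h (Equiv.swap a b * I) J z μ =
      theta q h * theta q (z b / z a * (μ (I⁻¹ b) / μ (I⁻¹ a))) * fixedWeight q h I J z μ -
        theta q (h * (z a / z b)) * theta q (μ (I⁻¹ b) / μ (I⁻¹ a)) *
          fixedWeight q h I (Equiv.swap a b * J) (z ∘ Equiv.swap a b) μ := by
  have hne : a ≠ b := by
    rintro rfl
    omega
  rcases lt_or_gt_of_ne (I⁻¹.injective.ne hne) with hI | hI
  · exact fixedWeight_exchange_of_lt hq0 hq hh hz hμ.1 hab I J hI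
  -- If `b` occurs before `a` in `I`, the ordered case applies to `s * I`, at `(J, z)` and at `(s *
  -- J, z ∘ s)`. Eliminating the weight at `(s * I, s * J, z ∘ s)` leaves the quadratic theta
  -- identity.
  set s := Equiv.swap a b with hs
  have ha : (s * I)⁻¹ a = I⁻¹ b := by
    rw [mul_inv_rev, Equiv.Perm.mul_apply, hs, Equiv.swap_inv, Equiv.swap_apply_left]
  have hb : (s * I)⁻¹ b = I⁻¹ a := by
    rw [mul_inv_rev, Equiv.Perm.mul_apply, hs, Equiv.swap_inv, Equiv.swap_apply_right]
  have h₁ := fixedWeight_exchange_of_lt hq0 hq hh hz hμ.1 hab (s * I) J (by rwa [ha, hb])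
  have h₂ := fixedWeight_exchange_of_lt hq0 hq hh (hz.comp s) hμ.1 hab (s * I) (s * J)
    (by rwa [ha, hb])
  rw [ha, hb, swap_mul_swap_mul] at h₁
  rw [ha, hb, swap_mul_swap_mul, swap_mul_swap_mul, comp_swap_comp_swap] at h₂
  simp only [hs, Function.comp_apply, Equiv.swap_apply_left, Equiv.swap_apply_right] at h₂
  rw [← hs] at h₁ h₂
  have hm0 : μ (I⁻¹ b) / μ (I⁻¹ a) ≠ 0 := div_ne_zero (hμ.1 _) (hμ.1 _)
  have hZ0 : z b / z a ≠ 0 := div_ne_zero (hz.1 _) (hz.1 _)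
  have hD₁ : theta q (h * (μ (I⁻¹ a) / μ (I⁻¹ b))) ≠ 0 := (hμ.2 _ _ (by simpa using hne)).2
  have hD₂ := (hz.2 b a hne.symm).1
  rw [← inv_div (μ (I⁻¹ b))] at hD₁ h₁ h₂
  rw [← inv_div (z b)] at h₁ h₂ ⊢
  generalize μ (I⁻¹ b) / μ (I⁻¹ a) = m at *
  generalize z b / z a = Z at *
  have h₃ := theta_quadratic hq0 hq hh hZ0 hm0
  rw [theta_inv] at h₁
  rw [theta_inv, ← mul_inv, theta_inv, theta_inv] at h₂
  refine mul_left_cancel₀ (mul_ne_zero hD₁ hD₂) ?_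
  linear_combination -fixedWeight q h (s * I) J z μ * h₃ - theta q h * theta q (Z * m) * h₁ -
    theta q (h * Z⁻¹) * theta q m * h₂

/-- An adjacent transposition reverses the order of just one pair, so only that factor of the
product changes. -/
theorem prod_Iio_comp_swap {M : Type*} [CommMonoid M] (G : Fin n → Fin n → M) {a b : Fin n}
    (hab : (b : ℕ) = a + 1) :
    (∏ k, ∏ i ∈ Iio k, G (Equiv.swap a b k) (Equiv.swap a b i)) * G b a =
      (∏ k, ∏ i ∈ Iio k, G k i) * G a b := by
  have hlt : a < b := by
    rw [Fin.lt_def]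
    omega
  simp only [prod_sigma']
  have hmem : (⟨b, a⟩ : Σ _ : Fin n, Fin n) ∈ univ.sigma fun k => Iio k := by simpa using hlt
  rw [← mul_prod_erase _ _ hmem, ← mul_prod_erase _ _ hmem]
  have he : ∏ x ∈ (univ.sigma fun k : Fin n => Iio k).erase ⟨b, a⟩,
      G (Equiv.swap a b x.1) (Equiv.swap a b x.2) =
      ∏ x ∈ (univ.sigma fun k : Fin n => Iio k).erase ⟨b, a⟩, G x.1 x.2 := by
    refine prod_nbij' (fun x => ⟨Equiv.swap a b x.1, Equiv.swap a b x.2⟩)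
      (fun x => ⟨Equiv.swap a b x.1, Equiv.swap a b x.2⟩) ?_ ?_ ?_ ?_ ?_
    · rintro ⟨c, d⟩ hx
      simp only [mem_erase, mem_sigma, mem_univ, mem_Iio, true_and, ne_eq, Sigma.mk.injEq,
        heq_eq_eq, Equiv.swap_apply_def, Fin.lt_def, Fin.ext_iff] at hx ⊢
      split_ifs <;> omega
    · rintro ⟨c, d⟩ hx
      simp only [mem_erase, mem_sigma, mem_univ, mem_Iio, true_and, ne_eq, Sigma.mk.injEq,
        heq_eq_eq, Equiv.swap_apply_def, Fin.lt_def, Fin.ext_iff] at hx ⊢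
      split_ifs <;> omega
    · simp
    · simp
    · simp
  rw [he]
  simp only [Equiv.swap_apply_left, Equiv.swap_apply_right]
  rw [mul_right_comm, mul_comm (G a b), mul_right_comm]

theorem fixedWeight_one (hz : IsGeneric q h z) : fixedWeight q h 1 1 z μ =
    (∏ k : Fin n, ∏ a ∈ Iio k, theta q (h * (μ k / μ a))) *
      ∏ k : Fin n, ∏ a ∈ Iio k, theta q (z k / z a) := by
  rw [fixedWeight_self hz]
  simp only [← prod_mul_distrib]
  refine prod_congr rfl fun k _ => prod_congr rfl fun a ha => ?_
  have hlt : ¬(1 : Equiv.Perm (Fin n)) k < (1 : Equiv.Perm (Fin n)) a := (mem_Iio.mp ha).not_gt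
  rw [if_neg hlt]
  rfl

theorem fixedWeight_one_comp_param (hz : IsGeneric q h z) {a b : Fin n} (hab : (b : ℕ) = a + 1) :
    fixedWeight q h 1 1 z (μ ∘ Equiv.swap a b) * theta q (h * (μ b / μ a)) =
      fixedWeight q h 1 1 z μ * theta q (h * (μ a / μ b)) := by
  rw [fixedWeight_one hz, fixedWeight_one hz]
  have := prod_Iio_comp_swap (fun i j => theta q (h * (μ i / μ j))) hab
  simp only [Function.comp_apply]
  linear_combination (∏ k : Fin n, ∏ a ∈ Iio k, theta q (z k / z a)) * this

theorem fixedWeight_one_comp_swap (hz : IsGeneric q h z) {a b : Fin n} (hab : (b : ℕ) = a + 1) :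
    fixedWeight q h 1 1 (z ∘ Equiv.swap a b) μ = -fixedWeight q h 1 1 z μ := by
  have hne : b ≠ a := by
    rintro rfl
    omega
  rw [fixedWeight_one hz, fixedWeight_one (hz.comp _)]
  have := prod_Iio_comp_swap (fun i j => theta q (z i / z j)) hab
  simp only [Function.comp_apply]
  rw [← inv_div (z b) (z a), theta_inv] at this
  refine mul_right_cancel₀ (hz.2 b a hne).1 ?_
  linear_combination (∏ k : Fin n, ∏ a ∈ Iio k, theta q (h * (μ k / μ a))) * this

theorem fixedWeight_one_left {J : Equiv.Perm (Fin n)} (hz : IsGeneric q h z) (hJ : J ≠ 1) :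
    fixedWeight q h 1 J z μ = 0 :=
  fixedWeight_eq_zero hz.1 hJ.symm (.inl fun _ => rfl)

theorem perm_induction {P : Equiv.Perm (Fin n) → Prop} (I : Equiv.Perm (Fin n)) (one : P 1)
    (swap_mul : ∀ (a b : Fin n) (I : Equiv.Perm (Fin n)), (b : ℕ) = a + 1 → P I →
      P (Equiv.swap a b * I)) : P I := by
  cases n with
  | zero => rwa [Subsingleton.elim I 1]
  | succ n =>
    have hI : I ∈ Submonoid.closure
        (Set.range fun i : Fin n => Equiv.swap i.castSucc i.succ) := by
      rw [Equiv.Perm.mclosure_swap_castSucc_succ]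
      trivial
    induction hI using Submonoid.closure_induction_left with
    | one => exact one
    | mul_left x hx y _ ih =>
      obtain ⟨i, rfl⟩ := hx
      exact swap_mul _ _ _ (by simp) ih

/-- The Bott–Samelson recursion for the restriction matrix. -/
theorem fixedWeight_exchange_right (hq0 : q ≠ 0) (hq : ‖q‖ < 1) (hh : h ≠ 0)
    (hz : IsGeneric q h z) (hμ : IsGeneric q h μ) {a b : Fin n} (hab : (b : ℕ) = a + 1)
    (I J : Equiv.Perm (Fin n)) :
    theta q (h * (μ a / μ b)) * theta q (z (J b) / z (J a)) *
        fixedWeight q h (I * Equiv.swap a b) J z μ =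
      theta q h * theta q (z (J b) / z (J a) * (μ b / μ a)) *
          fixedWeight q h I J z (μ ∘ Equiv.swap a b) -
        theta q (h * (z (J b) / z (J a))) * theta q (μ b / μ a) *
          fixedWeight q h I (J * Equiv.swap a b) z (μ ∘ Equiv.swap a b) := by
  have hne : a ≠ b := by
    rintro rfl
    omega
  induction I using perm_induction generalizing J z with
  -- For `I = 1` left and right multiplication by the transposition agree, so the left relation
  -- gives the claim after comparing the diagonal entries. Triangularity leaves `J = 1` and `J =
  -- swap a b` as the cases with nonzero terms.
  | one =>
    have hD₁ := (hμ.2 b a hne.symm).2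
    have hD₂ := (hz.2 b a hne.symm).1
    have hs : Equiv.swap a b ≠ 1 := fun e => hne (Equiv.swap_eq_one_iff.mp e)
    have he := fixedWeight_exchange hq0 hq hh hz hμ hab 1 J
    simp only [inv_one, Equiv.Perm.one_apply, mul_one, one_mul] at he ⊢
    have hp := fixedWeight_one_comp_param (μ := μ) hz hab
    by_cases hJ : J = 1
    · subst hJ
      simp only [mul_one, one_mul, Equiv.Perm.one_apply, fixedWeight_one_left hz hs,
        fixedWeight_one_left (hz.comp (Equiv.swap a b)) hs, mul_zero, sub_zero] at he ⊢
      refine mul_left_cancel₀ hD₁ ?_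
      linear_combination theta q (h * (μ a / μ b)) * he -
        theta q h * theta q (z b / z a * (μ b / μ a)) * hp
    · by_cases hJ' : J = Equiv.swap a b
      · subst hJ'
        simp only [Equiv.swap_mul_self, fixedWeight_one_left hz hs, mul_zero, zero_sub,
          Equiv.swap_apply_left, Equiv.swap_apply_right, fixedWeight_one_comp_swap hz hab]
          at he ⊢
        rw [← inv_div (z b), theta_inv] at *
        refine mul_left_cancel₀ hD₁ ?_
        linear_combination -theta q (h * (μ a / μ b)) * he +
          theta q (h * (z b / z a)⁻¹) * theta q (μ b / μ a) * hp
      · have h₁ : Equiv.swap a b * J ≠ 1 := by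
          intro e
          rw [mul_eq_one_iff_inv_eq, Equiv.swap_inv] at e
          exact hJ' e.symm
        have h₂ : J * Equiv.swap a b ≠ 1 := by
          intro e
          rw [mul_eq_one_iff_eq_inv, Equiv.swap_inv] at e
          exact hJ' e
        rw [fixedWeight_one_left hz hJ, fixedWeight_one_left (hz.comp _) h₁, mul_zero, mul_zero,
          sub_zero] at he
        have := (mul_eq_zero.mp he).resolve_left (mul_ne_zero hD₁ hD₂)
        rw [this, fixedWeight_one_left hz hJ, fixedWeight_one_left hz h₂]
        ring
  -- The left relation is applied to each of the three weights. Its coefficients match because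
  -- moving positions in `I` and permuting `μ` give the same ratio `m`; the inductive hypothesis is
  -- used at `(J, z)` and at `(s * J, z ∘ s)` with `s = swap c d`.
  | swap_mul c d I hcd ih =>
    have hne' : c ≠ d := by
      rintro rfl
      omega
    have h₁ := ih hz J
    have h₂ := ih (hz.comp (Equiv.swap c d)) (Equiv.swap c d * J)
    have h₃ := fixedWeight_exchange hq0 hq hh hz hμ hcd (I * Equiv.swap a b) J
    have h₄ := fixedWeight_exchange hq0 hq hh hz (hμ.comp (Equiv.swap a b)) hcd I J
    have h₅ := fixedWeight_exchange hq0 hq hh hz (hμ.comp (Equiv.swap a b)) hcd I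
      (J * Equiv.swap a b)
    have hinv (e : Fin n) : (I * Equiv.swap a b)⁻¹ e = Equiv.swap a b (I⁻¹ e) := by
      rw [mul_inv_rev, Equiv.swap_inv, Equiv.Perm.mul_apply]
    simp only [hinv, Function.comp_apply, Equiv.Perm.mul_apply, Equiv.swap_apply_self,
      ← mul_assoc] at h₁ h₂ h₃ h₄ h₅ ⊢
    have hD₁ := (hμ.2 (Equiv.swap a b (I⁻¹ d)) (Equiv.swap a b (I⁻¹ c)) (by
      simpa using hne'.symm)).2
    have hD₂ := (hz.2 d c hne'.symm).1
    refine mul_left_cancel₀ (mul_ne_zero hD₁ hD₂) ?_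
    generalize μ (Equiv.swap a b (I⁻¹ d)) / μ (Equiv.swap a b (I⁻¹ c)) = m at *
    linear_combination theta q (h * (μ a / μ b)) * theta q (z (J b) / z (J a)) * h₃ +
      theta q h * theta q (z d / z c * m) * h₁ - theta q (h * (z c / z d)) * theta q m * h₂ -
      theta q h * theta q (z (J b) / z (J a) * (μ b / μ a)) * h₄ +
      theta q (h * (z (J b) / z (J a))) * theta q (μ b / μ a) * h₅

variable (q h) in
/-- The right hand side of the mirror symmetry, up to sign. -/
def mirrorWeight (I J : Equiv.Perm (Fin n)) (z μ : Fin n → ℂ) : ℂ :=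
  fixedWeight q h (Fin.revPerm * J⁻¹) (Fin.revPerm * I⁻¹) (μ ∘ Fin.revPerm) z⁻¹

/-- Inversion turns left into right multiplication, so this is the right recursion taken at `(z ∘
swap)⁻¹`, with its left-hand term and its last term interchanged. -/
theorem mirrorWeight_exchange (hq0 : q ≠ 0) (hq : ‖q‖ < 1) (hh : h ≠ 0)
    (hz : IsGeneric q h z) (hμ : IsGeneric q h μ) {a b : Fin n} (hab : (b : ℕ) = a + 1)
    (I J : Equiv.Perm (Fin n)) :
    theta q (h * (μ (I⁻¹ b) / μ (I⁻¹ a))) * theta q (z b / z a) *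
        mirrorWeight q h (Equiv.swap a b * I) J z μ =
      theta q h * theta q (z b / z a * (μ (I⁻¹ b) / μ (I⁻¹ a))) * mirrorWeight q h I J z μ -
        theta q (h * (z a / z b)) * theta q (μ (I⁻¹ b) / μ (I⁻¹ a)) *
          mirrorWeight q h I (Equiv.swap a b * J) (z ∘ Equiv.swap a b) μ := by
  have he := fixedWeight_exchange_right hq0 hq hh (hμ.comp Fin.revPerm)
    (hz.inv.comp (Equiv.swap a b)) hab (Fin.revPerm * J⁻¹) (Fin.revPerm * I⁻¹)
  rw [comp_swap_comp_swap] at he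
  simp only [Function.comp_apply, Equiv.swap_apply_left, Equiv.swap_apply_right, Pi.inv_apply,
    inv_div_inv, Equiv.Perm.mul_apply, Fin.revPerm_apply, Fin.rev_rev] at he
  have h₁ : Fin.revPerm * (Equiv.swap a b * I)⁻¹ = Fin.revPerm * I⁻¹ * Equiv.swap a b := by
    rw [mul_inv_rev, Equiv.swap_inv, mul_assoc]
  have h₂ : Fin.revPerm * (Equiv.swap a b * J)⁻¹ = Fin.revPerm * J⁻¹ * Equiv.swap a b := by
    rw [mul_inv_rev, Equiv.swap_inv, mul_assoc]
  have h₃ : (z ∘ Equiv.swap a b)⁻¹ = z⁻¹ ∘ Equiv.swap a b := rfl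
  simp only [mirrorWeight, h₁, h₂, h₃]
  rw [mul_comm (z b / z a) (μ (I⁻¹ b) / μ (I⁻¹ a))]
  linear_combination he

/-- On the mirror side `I = 1` becomes the longest permutation in the second index, so both rows are
supported at `J = 1`. There every pair is inverted on the mirror side, which interchanges the roles
of `z` and `μ` in the diagonal product. -/
theorem fixedWeight_one_eq_mirrorWeight (hz : IsGeneric q h z) (hμ : IsGeneric q h μ)
    (J : Equiv.Perm (Fin n)) :
    fixedWeight q h 1 J z μ = (-1) ^ (n * (n - 1) / 2) * mirrorWeight q h 1 J z μ := by
  by_cases hJ : J = 1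
  · subst hJ
    have hsign : (-1 : ℂ) ^ (n * (n - 1) / 2) = ∏ k : Fin n, ∏ a ∈ Iio k, (-1 : ℂ) := by
      rw [← Finset.sum_range_id, ← prod_pow_eq_pow_sum, prod_range]
      refine prod_congr rfl fun k _ => ?_
      rw [prod_const, Fin.card_Iio]
    rw [fixedWeight_one hz, mirrorWeight, inv_one, mul_one, fixedWeight_self (hμ.comp _), hsign]
    simp only [← prod_mul_distrib]
    refine prod_congr rfl fun k _ => prod_congr rfl fun a ha => ?_
    have hlt : (Fin.revPerm k : Fin n) < Fin.revPerm a := by simpa using mem_Iio.mp ha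
    rw [if_pos hlt]
    simp only [Function.comp_apply, Fin.revPerm_apply, Fin.rev_rev, Pi.inv_apply, inv_div_inv]
    rw [← inv_div (z k), theta_inv]
    ring
  · rw [fixedWeight_one_left hz hJ, mirrorWeight, fixedWeight_eq_zero (hμ.comp _).1, mul_zero]
    · simpa using hJ
    · exact .inr fun m => by simp

/-- Mirror symmetry of the restriction matrix for generic parameters. -/
theorem fixedWeight_eq_mirrorWeight (hq0 : q ≠ 0) (hq : ‖q‖ < 1) (hh : h ≠ 0)
    (hz : IsGeneric q h z) (hμ : IsGeneric q h μ) (I J : Equiv.Perm (Fin n)) :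
    fixedWeight q h I J z μ = (-1) ^ (n * (n - 1) / 2) * mirrorWeight q h I J z μ := by
  induction I using perm_induction generalizing J z with
  | one => exact fixedWeight_one_eq_mirrorWeight hz hμ J
  | swap_mul a b I hab ih =>
    have hne : b ≠ a := by
      rintro rfl
      omega
    have h₁ := fixedWeight_exchange hq0 hq hh hz hμ hab I J
    have h₂ := mirrorWeight_exchange hq0 hq hh hz hμ hab I J
    rw [ih hz, ih (hz.comp _)] at h₁
    refine mul_left_cancel₀ (mul_ne_zero (hμ.2 (I⁻¹ b) (I⁻¹ a) (by simpa using hne)).2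
      (hz.2 b a hne).1) ?_
    linear_combination h₁ - (-1) ^ (n * (n - 1) / 2) * h₂

end Recursions

/-! ### Continuity and deformation to generic parameters. -/

section Deformation

variable {n : ℕ} {q h : ℂ} {z μ : Fin n → ℂ}

section Continuity

variable {X : Type*} [TopologicalSpace X] {x₀ : X}

theorem ContinuousAt.theta (hq : ‖q‖ < 1) {f : X → ℂ} (hf : ContinuousAt f x₀)
    (h₀ : f x₀ ≠ 0) : ContinuousAt (fun x => theta q (f x)) x₀ :=
  ContinuousAt.comp (f := f) (continuousAt_theta hq h₀) hf

theorem ContinuousAt.finset_prod {ι : Type*} {f : X → ι → ℂ} (s : Finset ι)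
    (hf : ∀ i, ContinuousAt (fun x => f x i) x₀) : ContinuousAt (fun x => ∏ i ∈ s, f x i) x₀ :=
  tendsto_finsetProd s fun i _ => hf i

theorem extendRoots_ne_zero {t : ChernRoots n} {z : Fin n → ℂ} (ht : ∀ k a, t k a ≠ 0)
    (hz : ∀ i, z i ≠ 0) (k : Fin (n + 1)) (a : Fin k) : extendRoots t z k a ≠ 0 := by
  induction k using Fin.lastCases with
  | last => rw [extendRoots_last]; exact hz a
  | cast k => rw [extendRoots_castSucc]; exact ht k a

theorem continuousAt_extendRoots {t : X → ChernRoots n} {z : X → Fin n → ℂ}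
    (ht : ∀ k a, ContinuousAt (fun x => t x k a) x₀) (hz : ∀ i, ContinuousAt (fun x => z x i) x₀)
    (k : Fin (n + 1)) (a : Fin k) : ContinuousAt (fun x => extendRoots (t x) (z x) k a) x₀ := by
  induction k using Fin.lastCases with
  | last => simp only [extendRoots_last]; exact hz a
  | cast k => simp only [extendRoots_castSucc]; exact ht k a

theorem continuousAt_preWeight (hq : ‖q‖ < 1) (I : Equiv.Perm (Fin n)) {h : X → ℂ}
    {t : X → ChernRoots n} {z μ : X → Fin n → ℂ} (hh : ContinuousAt h x₀)
    (ht : ∀ k a, ContinuousAt (fun x => t x k a) x₀) (hz : ∀ i, ContinuousAt (fun x => z x i) x₀)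
    (hμ : ∀ i, ContinuousAt (fun x => μ x i) x₀) (hh₀ : h x₀ ≠ 0) (ht₀ : ∀ k a, t x₀ k a ≠ 0)
    (hz₀ : ∀ i, z x₀ i ≠ 0) (hμ₀ : ∀ i, μ x₀ i ≠ 0) (hD : DenominatorsNonzero q (h x₀) (t x₀)) :
    ContinuousAt (fun x => preWeight q (h x) I (t x) (z x) (μ x)) x₀ := by
  unfold preWeight
  refine ContinuousAt.finset_prod _ fun k => ContinuousAt.div
    (ContinuousAt.finset_prod _ fun a => ContinuousAt.finset_prod _ fun c => ?_)
    (ContinuousAt.finset_prod _ fun a => ContinuousAt.finset_prod _ fun b => ?_) ?_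
  · have hc := (continuousAt_extendRoots ht hz k.succ c).div
      (continuousAt_extendRoots ht hz k.castSucc a) (extendRoots_ne_zero ht₀ hz₀ _ _)
    have hc₀ := div_ne_zero (extendRoots_ne_zero ht₀ hz₀ k.succ c)
      (extendRoots_ne_zero ht₀ hz₀ k.castSucc a)
    simp only [psi]
    split_ifs
    · exact ContinuousAt.theta hq (hh.mul hc) (mul_ne_zero hh₀ hc₀)
    · refine ContinuousAt.theta hq (((hc.mul (hh.zpow₀ _ (.inl hh₀))).mul (hμ _)).div (hμ _)
        (hμ₀ _)) ?_
      exact div_ne_zero (mul_ne_zero (mul_ne_zero hc₀ (zpow_ne_zero _ hh₀)) (hμ₀ _)) (hμ₀ _)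
    · exact ContinuousAt.theta hq hc hc₀
  · exact (ContinuousAt.theta hq (((ht k a).mul hh).div (ht k b) (ht₀ _ _))
      (div_ne_zero (mul_ne_zero (ht₀ _ _) hh₀) (ht₀ _ _))).mul
      (ContinuousAt.theta hq ((ht k b).div (ht k a) (ht₀ _ _)) (div_ne_zero (ht₀ _ _) (ht₀ _ _)))
  · refine prod_ne_zero_iff.mpr fun a _ => prod_ne_zero_iff.mpr fun b hb => ?_
    have := hD k a b (mem_Ioi.mp hb).ne
    exact mul_ne_zero this.1 this.2

theorem continuousAt_restrictionMatrix (hq : ‖q‖ < 1) (I J : Equiv.Perm (Fin n)) {h : X → ℂ}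
    {z μ : X → Fin n → ℂ} (hh : ContinuousAt h x₀) (hz : ∀ i, ContinuousAt (fun x => z x i) x₀)
    (hμ : ∀ i, ContinuousAt (fun x => μ x i) x₀) (hh₀ : h x₀ ≠ 0) (hz₀ : ∀ i, z x₀ i ≠ 0)
    (hμ₀ : ∀ i, μ x₀ i ≠ 0) (hD : DenominatorsNonzero q (h x₀) (fixedPointRoots (z x₀) J)) :
    ContinuousAt (fun x => restrictionMatrix q (h x) I J (z x) (μ x)) x₀ := by
  unfold restrictionMatrix weight
  refine tendsto_finsetSum _ fun τ _ => ?_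
  refine continuousAt_preWeight hq I hh (fun k a => hz _) hz hμ hh₀ (fun k a => hz₀ _) hz₀ hμ₀ ?_
  exact fun k a b hab => hD k (τ k a) (τ k b) ((τ k).injective.ne hab)

end Continuity

/-- Each of the countably many values `q ^ k` is met for at most one real `ε`, since the real
exponential is injective. -/
theorem countable_theta_mul_exp_eq_zero (hq : ‖q‖ < 1) {r : ℂ} (hr : r ≠ 0) {c : ℝ}
    (hc : c ≠ 0) : {ε : ℝ | theta q (r * Complex.exp (ε * c : ℝ)) = 0}.Countable := by
  refine Set.Countable.mono (s₂ := ⋃ k : ℤ, {ε : ℝ | (r * Complex.exp (ε * c : ℝ)) ^ 2 = q ^ k})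
    (fun ε hε => ?_) (Set.countable_iUnion fun k => Set.Subsingleton.countable ?_)
  · by_contra hcon
    simp only [Set.mem_iUnion, Set.mem_ofPred_eq, not_exists] at hcon
    exact theta_ne_zero hq (mul_ne_zero hr (Complex.exp_ne_zero _)) hcon hε
  · intro ε₁ h₁ ε₂ h₂
    have he := h₁.trans h₂.symm
    rw [mul_pow, mul_pow, mul_right_inj' (pow_ne_zero 2 hr), ← Complex.ofReal_exp,
      ← Complex.ofReal_exp, ← Complex.ofReal_pow, ← Complex.ofReal_pow, Complex.ofReal_inj,
      pow_left_inj₀ (Real.exp_pos _).le (Real.exp_pos _).le two_ne_zero, Real.exp_eq_exp] at he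
    exact mul_right_cancel₀ hc he

/-- The deformation of a tuple of parameters to a generic one. -/
def deform (z : Fin n → ℂ) (ε : ℝ) (i : Fin n) : ℂ := z i * Complex.exp (ε * (i : ℕ) : ℝ)

theorem continuous_deform (z : Fin n → ℂ) (i : Fin n) : Continuous fun ε => deform z ε i := by
  unfold deform
  fun_prop

theorem deform_zero (z : Fin n → ℂ) : deform z 0 = z := by
  funext i
  simp [deform]

/-- The theta arguments vary with exponents `i - j` and `n + i - j`, both nonzero for distinct `i, j
< n`. -/
theorem countable_not_isGeneric_deform (hq : ‖q‖ < 1) (hh : h ≠ 0) (hz : ∀ i, z i ≠ 0) :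
    {ε : ℝ | ¬IsGeneric q (h * Complex.exp (ε * n : ℝ)) (deform z ε)}.Countable := by
  have hsub : {ε : ℝ | ¬IsGeneric q (h * Complex.exp (ε * n : ℝ)) (deform z ε)} ⊆
      ⋃ p : {p : Fin n × Fin n // p.1 ≠ p.2},
        {ε : ℝ | theta q (z p.1.1 / z p.1.2 *
          Complex.exp (ε * ((p.1.1 : ℕ) - (p.1.2 : ℕ) : ℝ) : ℝ)) = 0} ∪
        {ε : ℝ | theta q (h * (z p.1.1 / z p.1.2) *
          Complex.exp (ε * (n + (p.1.1 : ℕ) - (p.1.2 : ℕ) : ℝ) : ℝ)) = 0} := by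
    intro ε hε
    by_contra hcon
    simp only [Set.mem_iUnion, Set.mem_union, Set.mem_ofPred_eq, not_exists, not_or] at hcon
    refine hε ⟨fun i => mul_ne_zero (hz i) (Complex.exp_ne_zero _), fun i j hij => ?_⟩
    have h₁ : deform z ε i / deform z ε j =
        z i / z j * Complex.exp (ε * ((i : ℕ) - (j : ℕ) : ℝ) : ℝ) := by
      rw [deform, deform, mul_sub, Complex.ofReal_sub, Complex.exp_sub, mul_div_mul_comm]
    have h₂ : h * Complex.exp (ε * n : ℝ) * (deform z ε i / deform z ε j) =
        h * (z i / z j) * Complex.exp (ε * (n + (i : ℕ) - (j : ℕ) : ℝ) : ℝ) := by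
      rw [h₁, add_sub_assoc, mul_add, Complex.ofReal_add, Complex.exp_add]
      ring
    rw [h₂, h₁]
    exact hcon ⟨(i, j), hij⟩
  refine Set.Countable.mono hsub (Set.countable_iUnion fun p => Set.Countable.union ?_ ?_)
  · refine countable_theta_mul_exp_eq_zero hq (div_ne_zero (hz _) (hz _)) (sub_ne_zero.mpr ?_)
    exact_mod_cast fun e => p.2 (Fin.ext e)
  · refine countable_theta_mul_exp_eq_zero hq (mul_ne_zero hh (div_ne_zero (hz _) (hz _)))
      (sub_ne_zero.mpr ?_)
    have := p.1.2.2
    exact_mod_cast (by omega : n + (p.1.1 : ℕ) ≠ (p.1.2 : ℕ))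

end Deformation

end FlagMirror

end

/-! ### Passage from generic to arbitrary parameters. -/

theorem mainTheorem2 (n : ℕ) (q : ℂ) (hq0 : q ≠ 0) (hq1 : ‖q‖ < 1)
    (h : ℂ) (z μ : Fin n → ℂ) (hh : h ≠ 0) (hz : ∀ i, z i ≠ 0) (hμ : ∀ i, μ i ≠ 0)
    (I J : Equiv.Perm (Fin n))
    (hL : FlagMirror.DenominatorsNonzero q h (FlagMirror.fixedPointRoots z J))
    (hR : FlagMirror.DenominatorsNonzero q h
      (FlagMirror.fixedPointRoots (fun i => μ (Fin.revPerm i)) (I.symm.trans Fin.revPerm))) :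
    FlagMirror.restrictionMatrix q h I J z μ =
      (-1 : ℂ) ^ (n * (n - 1) / 2) *
        FlagMirror.restrictionMatrix q h
          (J.symm.trans Fin.revPerm) (I.symm.trans Fin.revPerm)
          (fun i => μ (Fin.revPerm i)) (fun i => (z i)⁻¹) := by
  open FlagMirror in
  let H : ℝ → ℂ := fun ε => h * Complex.exp (ε * n : ℝ)
  have hH : Continuous H := by fun_prop
  have hH0 : H 0 = h := by simp [H]
  let G : Set ℝ := ({ε | ¬IsGeneric q (H ε) (deform z ε)} ∪
    {ε | ¬IsGeneric q (H ε) (deform μ ε)})ᶜ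
  -- The complement of a countable set of real numbers is dense, so `0` is a limit of generic
  -- parameters and both continuous sides have equal limits there.
  have hG : Dense G := ((countable_not_isGeneric_deform hq1 hh hz).union
    (countable_not_isGeneric_deform hq1 hh hμ)).dense_compl ℝ
  have hne : (nhdsWithin (0 : ℝ) G).NeBot := mem_closure_iff_nhdsWithin_neBot.mp (hG 0)
  have h₁ : ContinuousAt (fun ε => restrictionMatrix q (H ε) I J (deform z ε) (deform μ ε)) 0 := by
    refine continuousAt_restrictionMatrix hq1 I J hH.continuousAt
      (fun i => (continuous_deform z i).continuousAt)
      (fun i => (continuous_deform μ i).continuousAt) ?_ ?_ ?_ ?_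
    all_goals simpa only [hH0, deform_zero]
  have h₂ : ContinuousAt (fun ε => restrictionMatrix q (H ε) (J.symm.trans Fin.revPerm)
      (I.symm.trans Fin.revPerm) (fun i => deform μ ε (Fin.revPerm i))
      (fun i => (deform z ε i)⁻¹)) 0 := by
    refine continuousAt_restrictionMatrix hq1 _ _ hH.continuousAt
      (fun i => (continuous_deform μ _).continuousAt)
      (fun i => (continuous_deform z i).continuousAt.inv₀ ?_) ?_ ?_ ?_ ?_
    all_goals simp only [hH0, deform_zero]
    exacts [hz i, hh, fun i => hμ _, fun i => inv_ne_zero (hz i), hR]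
  have h₃ : ∀ ε ∈ G, restrictionMatrix q (H ε) I J (deform z ε) (deform μ ε) =
      (-1 : ℂ) ^ (n * (n - 1) / 2) * restrictionMatrix q (H ε) (J.symm.trans Fin.revPerm)
        (I.symm.trans Fin.revPerm) (fun i => deform μ ε (Fin.revPerm i))
        (fun i => (deform z ε i)⁻¹) := by
    intro ε hε
    simp only [G, Set.mem_compl_iff, Set.mem_union, Set.mem_ofPred_eq, not_or, not_not] at hε
    rw [restrictionMatrix_eq, restrictionMatrix_eq]
    exact fixedWeight_eq_mirrorWeight hq0 hq1 (mul_ne_zero hh (Complex.exp_ne_zero _)) hε.1 hε.2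
      I J
  have h₄ := tendsto_nhds_unique_of_eventuallyEq (h₁.tendsto.mono_left nhdsWithin_le_nhds)
    ((h₂.tendsto.const_mul _).mono_left nhdsWithin_le_nhds)
    (Filter.eventually_of_mem self_mem_nhdsWithin h₃)
  simpa only [hH0, deform_zero] using h₄
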